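/- Let $\mathbb F$ be a field of characteristic zero and $n\ge 0$. Let $\Lambda_n$ be the $\mathbb F$-vector space of homogeneous symmetric functions of degree $n$ in the variables $x_1,x_2,\dots$; for a partition $\nu=(\nu_1,\nu_2,\dots)\vdash n$ write $h_\nu=h_{\nu_1}h_{\nu_2}\cdots$ and $p_\nu=p_{\nu_1}p_{\nu_2}\cdots$ for the complete homogeneous and power sum symmetric functions. The Frobenius image of a finite-dimensional $\mathfrak S_n$-module $V$ over $\mathbb F$ with character $\chi_V$ is $$\mathrm{Frob}(V)=\frac1{n!}\sum_{w\in\mathfrak S_n}\chi_V(w)\,p_{\mathrm{cyc}(w)}\in\Lambda_n,$$ where $\mathrm{cyc}(w)$ is the cycle type of $w$. Let $\mu=(\mu_1\ge\dots\ge\mu_k)\vdash n$. Let $a_1,\dots,a_r$ be the distinct part sizes of $\mu$, listed in any order, and let $m_i$ be the number of parts of $\mu$ equal to $a_i$. Let $\mathrm{Stab}(\mu)=\{u\in\mathfrak S_k:\mu_{u(i)}=\mu_i\text{ for all }i\}=\mathfrak S_{m_1}\times\cdots\times\mathfrak S_{m_r}$. For a finite-dimensional $\mathrm{Stab}(\mu)$-module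 $W$ let $$\mathrm{Frob}(W)=\frac1{|\mathrm{Stab}(\mu)|}\sum_{u=(u_1,\dots,u_r)}\chi_W(u)\;p_{\mathrm{cyc}(u_1)}\otimes\cdots\otimes p_{\mathrm{cyc}(u_r)}\in\Lambda_{m_1}\otimes\cdots\otimes\Lambda_{m_r}.$$ Cut $\{1,\dots,n\}$ into consecutive intervals $I_1,\dots,I_k$ of lengths $\mu_1,\dots,\mu_k$. Let $\mathfrak S_\mu\subseteq\mathfrak S_n$ be the subgroup of permutations preserving each $I_i$, let $\eta_\mu=\sum_{w\in\mathfrak S_\mu}w\in\mathbb F[\mathfrak S_n]$, and let $\iota_\mu:\mathrm{Stab}(\mu)\hookrightarrow\mathfrak S_n$ be the embedding for which $\iota_\mu(u)$ carries the $j$-th element of $I_i$ to the $j$-th element of $I_{u(i)}$. For an $\mathfrak S_n$-module $V$, the subspace $\eta_\mu V=\{\eta_\mu\cdot v: v\in V\}$ is a $\mathrm{Stab}(\mu)$-module via $u\cdot v=\iota_\mu(u)\cdot v$. A multiset partition of a multiset $S$ is a multiset $\pi=\{B_1,\dots,B_l\}$ of multisets whose multiset union is $S$; its shape is the partition listing the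 block sizes $\#B_1,\dots,\#B_l$ in weakly decreasing order. Write $\pi|_a$ for the multiset of blocks of $\pi$ of size $a$, and $\mathrm{type}(\pi|_a)$ for the partition whose parts are the multiplicities of the distinct blocks in $\pi|_a$. **Proposition.** There is a unique $\mathbb F$-linear map $\psi_\mu:\Lambda_n\to\Lambda_{m_1}\otimes\cdots\otimes\Lambda_{m_r}$ with $\psi_\mu(\mathrm{Frob}(V))=\mathrm{Frob}(\eta_\mu V)$ for every finite-dimensional $\mathfrak S_n$-module $V$ over $\mathbb F$. For every partition $\lambda\vdash n$ it satisfies $$\psi_\mu(h_\lambda)=\sum_{\pi}h_{\mathrm{type}(\pi|_{a_1})}\otimes\cdots\otimes h_{\mathrm{type}(\pi|_{a_r})},$$ where the sum is over all multiset partitions $\pi$ of $S=\{1^{\lambda_1},2^{\lambda_2},\dots\}$ of shape $\mu$. -/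

import Mathlib

open scoped TensorProduct

universe u

/-! ### Symmetric functions in the variables `x_0, x_1, x_2, …` -/

/-- `SymFun F n` is the space `Λ_n` of symmetric functions over `F`, homogeneous of degree `n`:
formal power series in infinitely many variables, all of whose monomials have degree `n`,
and which are invariant under permutations of the variables. -/
def SymFun (F : Type*) [Field F] (n : ℕ) : Submodule F (MvPowerSeries ℕ F) where
  carrier := {f | (∀ m : ℕ →₀ ℕ, MvPowerSeries.coeff m f ≠ 0 → m.degree = n) ∧
    ∀ (σ : Equiv.Perm ℕ) (m : ℕ →₀ ℕ),
      MvPowerSeries.coeff (m.mapDomain σ) f = MvPowerSeries.coeff m f}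
  zero_mem' := by simp
  add_mem' := by
    rintro f g ⟨hf, hf'⟩ ⟨hg, hg'⟩
    refine ⟨fun m hm => ?_, fun σ m => by simp [hf', hg']⟩
    by_contra h
    refine hm ?_
    rw [map_add, not_not.1 (mt (hf m) h), not_not.1 (mt (hg m) h), add_zero]
  smul_mem' := by
    rintro c f ⟨hf, hf'⟩
    refine ⟨fun m hm => hf m ?_, fun σ m => by simp [hf']⟩
    rintro h
    simp [h] at hm

namespace SymFun

variable (F : Type*) [Field F]

theorem one_mem : (1 : MvPowerSeries ℕ F) ∈ SymFun F 0 := by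
  classical
  refine ⟨fun m hm => ?_, fun σ m => ?_⟩
  · rw [MvPowerSeries.coeff_one] at hm
    by_contra h
    exact hm (if_neg fun h0 => h (by simp [h0]))
  · rw [MvPowerSeries.coeff_one, MvPowerSeries.coeff_one]
    congr 1
    rw [eq_iff_iff]
    constructor
    · intro h
      exact Finsupp.mapDomain_injective σ.injective (by simpa using h)
    · rintro rfl
      simp

variable {F}

theorem mul_mem {a b : ℕ} {f g : MvPowerSeries ℕ F} (hf : f ∈ SymFun F a)
    (hg : g ∈ SymFun F b) : f * g ∈ SymFun F (a + b) := by
  classical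
  refine ⟨fun m hm => ?_, fun σ m => ?_⟩
  · rw [MvPowerSeries.coeff_mul] at hm
    obtain ⟨p, hp, hp0⟩ := Finset.exists_ne_zero_of_sum_ne_zero hm
    rw [Finset.HasAntidiagonal.mem_antidiagonal] at hp
    rw [← hp, map_add, hf.1 _ (left_ne_zero_of_mul hp0), hg.1 _ (right_ne_zero_of_mul hp0)]
  · rw [MvPowerSeries.coeff_mul, MvPowerSeries.coeff_mul]
    symm
    have hinv : ∀ (τ : Equiv.Perm ℕ) (x : ℕ →₀ ℕ),
        (x.mapDomain τ).mapDomain τ.symm = x := fun τ x => by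
      rw [← Finsupp.mapDomain_comp, Equiv.symm_comp_self, Finsupp.mapDomain_id]
    have hinv' : ∀ (τ : Equiv.Perm ℕ) (x : ℕ →₀ ℕ),
        (x.mapDomain τ.symm).mapDomain τ = x := fun τ x => by
      rw [← Finsupp.mapDomain_comp, Equiv.self_comp_symm, Finsupp.mapDomain_id]
    refine Finset.sum_bij'
      (fun p _ => (p.1.mapDomain σ, p.2.mapDomain σ))
      (fun p _ => (p.1.mapDomain σ.symm, p.2.mapDomain σ.symm)) ?_ ?_ ?_ ?_ ?_
    · intro p hp
      rw [Finset.HasAntidiagonal.mem_antidiagonal] at hp ⊢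
      simp only
      rw [← Finsupp.mapDomain_add, hp]
    · intro p hp
      rw [Finset.HasAntidiagonal.mem_antidiagonal] at hp ⊢
      simp only
      rw [← Finsupp.mapDomain_add, hp, hinv]
    · intro p _
      simp only [hinv]
    · intro p _
      simp only [hinv']
    · intro p _
      simp only [hf.2, hg.2]

theorem prod_mem {f : ℕ → MvPowerSeries ℕ F} (hf : ∀ k, f k ∈ SymFun F k) (s : Multiset ℕ) :
    (s.map f).prod ∈ SymFun F s.sum := by
  induction s using Multiset.induction_on with
  | empty => simpa using one_mem F
  | cons a s ih => simpa using mul_mem (hf a) ih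

variable (F)

open Classical in
/-- The complete homogeneous symmetric function `h_k`: the sum of all monomials of degree `k`. -/
noncomputable def hSeries (k : ℕ) : MvPowerSeries ℕ F := fun m => if m.degree = k then 1 else 0

open Classical in
/-- The power sum `p_k = ∑ i, x_i ^ k` (used for `k ≥ 1` only). -/
noncomputable def pSeries (k : ℕ) : MvPowerSeries ℕ F :=
  fun m => if ∃ i, m = Finsupp.single i k then 1 else 0

theorem hSeries_mem (k : ℕ) : hSeries F k ∈ SymFun F k := by
  classical
  have key : ∀ m, MvPowerSeries.coeff m (hSeries F k) = if m.degree = k then 1 else 0 :=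
    fun m => rfl
  refine ⟨fun m hm => ?_, fun σ m => ?_⟩
  · by_contra h
    exact hm (by rw [key, if_neg h])
  · rw [key, key, Finsupp.degree_mapDomain]

theorem pSeries_mem (k : ℕ) : pSeries F k ∈ SymFun F k := by
  classical
  have key : ∀ m, MvPowerSeries.coeff m (pSeries F k) =
      if ∃ i, m = Finsupp.single i k then 1 else 0 := fun m => rfl
  refine ⟨fun m hm => ?_, fun σ m => ?_⟩
  · by_contra h
    refine hm ?_
    rw [key, if_neg]
    rintro ⟨i, rfl⟩
    exact h (by simp)
  · rw [key, key]
    congr 1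
    rw [eq_iff_iff]
    constructor
    · rintro ⟨i, hi⟩
      refine ⟨σ.symm i, Finsupp.mapDomain_injective σ.injective ?_⟩
      rw [hi, Finsupp.mapDomain_single, Equiv.apply_symm_apply]
    · rintro ⟨i, rfl⟩
      exact ⟨σ i, by rw [Finsupp.mapDomain_single]⟩

/-- `h_ν = h_{ν_1} h_{ν_2} ⋯ ∈ Λ_n` for a partition `ν` of `n`. -/
noncomputable def h {n : ℕ} (ν : n.Partition) : SymFun F n :=
  ⟨(ν.parts.map (hSeries F)).prod, by
    have := prod_mem (hSeries_mem F) ν.parts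
    rwa [ν.parts_sum] at this⟩

/-- `p_ν = p_{ν_1} p_{ν_2} ⋯ ∈ Λ_n` for a partition `ν` of `n`. -/
noncomputable def p {n : ℕ} (ν : n.Partition) : SymFun F n :=
  ⟨(ν.parts.map (pSeries F)).prod, by
    have := prod_mem (pSeries_mem F) ν.parts
    rwa [ν.parts_sum] at this⟩

end SymFun

/-- The cycle type of a permutation of an `m`-element set (fixed points included), as a
partition of `m`. -/
def cyc {α : Type*} [Fintype α] [DecidableEq α] {m : ℕ} (hm : Fintype.card α = m)
    (w : Equiv.Perm α) : m.Partition where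
  parts := w.partition.parts
  parts_pos := w.partition.parts_pos
  parts_sum := w.partition.parts_sum.trans hm

/-- The Frobenius image `Frob(V) = (1/n!) ∑_{w ∈ 𝔖_n} χ_V(w) p_{cyc(w)} ∈ Λ_n` of an
`𝔖_n`-module `V`. -/
noncomputable def frob {F V : Type*} [Field F] [AddCommGroup V] [Module F V] {n : ℕ}
    (ρ : Representation F (Equiv.Perm (Fin n)) V) : SymFun F n :=
  ((n.factorial : ℕ) : F)⁻¹ •
    ∑ w : Equiv.Perm (Fin n), ρ.character w • SymFun.p F (cyc (Fintype.card_fin n) w)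

/-! ### The parts of a partition, and the groups `𝔖_μ` and `Stab(μ)` -/

namespace Nat.Partition

variable {n : ℕ} (μ : n.Partition)

/-- The parts of `μ`, listed in weakly decreasing order. -/
def partList : List ℕ := μ.parts.sort (· ≥ ·)

/-- The number `ℓ(μ)` of parts. -/
abbrev length : ℕ := μ.partList.length

/-- The `i`-th part `μ_i`, where `μ_0 ≥ μ_1 ≥ ⋯`. -/
def part (i : Fin μ.length) : ℕ := μ.partList.get i

theorem map_part : (Finset.univ.val.map μ.part) = μ.parts := by
  have h : (μ.partList : Multiset ℕ) = μ.parts := Multiset.sort_eq _ _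
  rw [← h, Fin.univ_val_map]
  congr 1
  exact List.ofFn_get _

theorem sum_part : ∑ i, μ.part i = n := by
  rw [Finset.sum_eq_multiset_sum, map_part, μ.parts_sum]

theorem card_block (a : ℕ) : Fintype.card {j // μ.part j = a} = μ.parts.count a := by
  classical
  rw [Fintype.card_subtype, ← μ.map_part, Multiset.count_map]
  simp [Finset.card, eq_comm]

/-- The identification of the disjoint union of consecutive intervals of lengths
`μ_0, μ_1, …` with `{0, …, n - 1}`. -/
def blockEquiv : (Σ i : Fin μ.length, Fin (μ.part i)) ≃ Fin n :=
  finSigmaFinEquiv.trans (finCongr μ.sum_part)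

/-- The index of the interval that contains a given position. -/
def block (x : Fin n) : Fin μ.length := (μ.blockEquiv.symm x).1

/-- The parabolic (Young) subgroup `𝔖_μ ⊆ 𝔖_n` of the permutations that preserve each of the
consecutive intervals of lengths `μ_0, μ_1, …`. -/
def young : Subgroup (Equiv.Perm (Fin n)) where
  carrier := {w | ∀ x, μ.block (w x) = μ.block x}
  mul_mem' := by
    intro v w hv hw x
    rw [Equiv.Perm.mul_apply, hv, hw]
  one_mem' := fun x => rfl
  inv_mem' := by
    intro w hw x
    rw [← hw (w⁻¹ x), ← Equiv.Perm.mul_apply, mul_inv_cancel, Equiv.Perm.one_apply]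

/-- `Stab(μ) = {w ∈ 𝔖_k : μ_{w(i)} = μ_i for all i}` where `k = ℓ(μ)`. -/
def stab : Subgroup (Equiv.Perm (Fin μ.length)) where
  carrier := {w | ∀ i, μ.part (w i) = μ.part i}
  mul_mem' := by
    intro v w hv hw x
    rw [Equiv.Perm.mul_apply, hv, hw]
  one_mem' := fun x => rfl
  inv_mem' := by
    intro w hw x
    rw [← hw (w⁻¹ x), ← Equiv.Perm.mul_apply, mul_inv_cancel, Equiv.Perm.one_apply]

/-- The permutation of the disjoint union of the intervals which carries the `j`-th element of
the `i`-th interval to the `j`-th element of the `u(i)`-th interval. -/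
def iotaSigma (u : μ.stab) : Equiv.Perm (Σ i : Fin μ.length, Fin (μ.part i)) :=
  Equiv.sigmaCongr u.1 fun i => finCongr (u.2 i).symm

theorem iotaSigma_mul (u v : μ.stab) : μ.iotaSigma (u * v) = μ.iotaSigma u * μ.iotaSigma v := by
  ext x
  · rfl
  · rfl

/-- The embedding `ι_μ : Stab(μ) ↪ 𝔖_n`, which permutes intervals of equal length. -/
def iota : μ.stab →* Equiv.Perm (Fin n) where
  toFun u := μ.blockEquiv.permCongr (μ.iotaSigma u)
  map_one' := by
    have : μ.iotaSigma 1 = 1 := by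
      have h := μ.iotaSigma_mul 1 1
      rw [one_mul] at h
      exact left_eq_mul.1 h
    rw [this]
    ext x
    simp
  map_mul' u v := by
    rw [iotaSigma_mul]
    ext x
    simp [Equiv.permCongr_apply]

theorem block_iota (u : μ.stab) (x : Fin n) : μ.block (μ.iota u x) = u.1 (μ.block x) := by
  simp only [block, iota, MonoidHom.coe_mk, OneHom.coe_mk, Equiv.permCongr_apply,
    Equiv.symm_apply_apply]
  rfl

theorem conj_mem_young (u : μ.stab) {w : Equiv.Perm (Fin n)} (hw : w ∈ μ.young) :
    μ.iota u * w * (μ.iota u)⁻¹ ∈ μ.young := by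
  intro x
  rw [Equiv.Perm.mul_apply, Equiv.Perm.mul_apply, block_iota, hw, ← block_iota,
    ← Equiv.Perm.mul_apply, mul_inv_cancel, Equiv.Perm.one_apply]

/-! ### The symmetrizer `η_μ`, the `Stab(μ)`-module `η_μ V` and its Frobenius image -/

open Classical in
/-- The group algebra element `η_μ = ∑_{w ∈ 𝔖_μ} w`. -/
noncomputable def eta (F : Type*) [Field F] : MonoidAlgebra F (Equiv.Perm (Fin n)) :=
  ∑ w : μ.young, MonoidAlgebra.of F (Equiv.Perm (Fin n)) w.1

theorem of_iota_mul_eta (F : Type*) [Field F] (u : μ.stab) :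
    MonoidAlgebra.of F (Equiv.Perm (Fin n)) (μ.iota u) * μ.eta F =
      μ.eta F * MonoidAlgebra.of F (Equiv.Perm (Fin n)) (μ.iota u) := by
  classical
  rw [eta, Finset.mul_sum, Finset.sum_mul]
  refine Finset.sum_bij'
    (fun w _ => ⟨μ.iota u * w.1 * (μ.iota u)⁻¹, μ.conj_mem_young u w.2⟩)
    (fun w _ => ⟨(μ.iota u)⁻¹ * w.1 * μ.iota u, by
      have := μ.conj_mem_young u⁻¹ w.2
      simpa using this⟩) ?_ ?_ ?_ ?_ ?_
  · simp
  · simp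
  · intro w _
    ext1
    simp [mul_assoc]
  · intro w _
    ext1
    simp [mul_assoc]
  · intro w _
    rw [← map_mul, ← map_mul]
    simp

variable {F V : Type*} [Field F] [AddCommGroup V] [Module F V]

/-- The subspace `η_μ V = {η_μ · v : v ∈ V}`. -/
noncomputable def etaSubmodule (ρ : Representation F (Equiv.Perm (Fin n)) V) : Submodule F V :=
  LinearMap.range (ρ.asAlgebraHom (μ.eta F))

/-- The `Stab(μ)`-module structure `u · v = ι_μ(u) · v` on `η_μ V`. -/
noncomputable def etaRep (ρ : Representation F (Equiv.Perm (Fin n)) V) :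
    Representation F μ.stab (μ.etaSubmodule ρ) :=
  Representation.subrepresentation (ρ.comp μ.iota) (μ.etaSubmodule ρ) (by
    rintro u _ ⟨v, rfl⟩
    refine ⟨ρ (μ.iota u) v, ?_⟩
    have h := congrArg (fun x => ρ.asAlgebraHom x v) (μ.of_iota_mul_eta F u)
    simp only [map_mul, Representation.asAlgebraHom_of, Module.End.mul_apply] at h
    exact h.symm)

/-- The restriction of `u ∈ Stab(μ)` to the set of indices `j` with `μ_j = a`. -/
def stabRestrict (u : μ.stab) (a : ℕ) : Equiv.Perm {j // μ.part j = a} :=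
  u.1.subtypePerm fun j => by rw [u.2 j]

/-- Let `a_0, …, a_{r-1}` be the distinct part sizes of `μ`, and let `m_i` be the multiplicity of
`a_i`, so that `Stab(μ) = 𝔖_{m_0} × ⋯ × 𝔖_{m_{r-1}}`. The Frobenius image of a `Stab(μ)`-module
`W` is `(1/#Stab(μ)) ∑_u χ_W(u) p_{cyc(u_0)} ⊗ ⋯ ⊗ p_{cyc(u_{r-1})}`, an element of
`Λ_{m_0} ⊗ ⋯ ⊗ Λ_{m_{r-1}}`; here `u_i` is the component of `u` in `𝔖_{m_i}`. -/
noncomputable def frobStab {r : ℕ} (a : Fin r → ℕ) {W : Type*} [AddCommGroup W] [Module F W]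
    (ρ : Representation F μ.stab W) : ⨂[F] i, SymFun F (μ.parts.count (a i)) :=
  open Classical in
  (Nat.card μ.stab : F)⁻¹ •
    ∑ u : μ.stab, ρ.character u •
      PiTensorProduct.tprod F fun i => SymFun.p F (cyc (μ.card_block (a i)) (μ.stabRestrict u (a i)))

end Nat.Partition

/-- The property that characterizes the linear operator
`ψ_μ : Λ_n → Λ_{m_0} ⊗ ⋯ ⊗ Λ_{m_{r-1}}`: it sends `Frob(V)` to `Frob(η_μ V)`
for all finite-dimensional `𝔖_n`-modules `V`. -/
def IsPsi {F : Type u} [Field F] {n : ℕ} (μ : n.Partition) {r : ℕ} (a : Fin r → ℕ)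
    (ψ : SymFun F n →ₗ[F] ⨂[F] i, SymFun F (μ.parts.count (a i))) : Prop :=
  ∀ (V : Type u) [AddCommGroup V] [Module F V] [FiniteDimensional F V]
    (ρ : Representation F (Equiv.Perm (Fin n)) V),
    ψ (frob ρ) = μ.frobStab a (μ.etaRep ρ)

/-! ### Multiset partitions -/

/-- The multiset `{1^{λ_1}, 2^{λ_2}, …}`. -/
def contentMultiset {n : ℕ} (lam : n.Partition) : Multiset ℕ :=
  ∑ i : Fin lam.length, Multiset.replicate (lam.part i) (i.1 + 1)

/-- The multiset partitions of `S` of shape `μ`: the multisets `π = {B_1, …, B_k}` of multisets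
with multiset union `S` and with block cardinalities `#B_1, …, #B_k` equal, in some order, to
the parts of `μ`. -/
def MultisetPartition (S : Multiset ℕ) {n : ℕ} (μ : n.Partition) : Type :=
  {π : Multiset (Multiset ℕ) // π.sum = S ∧ π.map Multiset.card = μ.parts}

namespace MultisetPartition

variable {S : Multiset ℕ} {n : ℕ} {μ : n.Partition}

instance : Finite (MultisetPartition S μ) := by
  classical
  refine Set.Finite.to_subtype (s := {π : Multiset (Multiset ℕ) |
    π.sum = S ∧ π.map Multiset.card = μ.parts}) ?_
  refine Set.Finite.subset
    (((Multiset.card μ.parts) • S.powerset).powerset.toFinset.finite_toSet) ?_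
  rintro π ⟨h1, h2⟩
  simp only [Finset.mem_coe, Multiset.mem_toFinset, Multiset.mem_powerset]
  rw [Multiset.le_iff_count]
  intro B
  by_cases hB : B ∈ π
  · have hle : B ≤ S := h1 ▸ Multiset.le_sum_of_mem hB
    have h3 : 1 ≤ S.powerset.count B :=
      Multiset.one_le_count_iff_mem.2 (Multiset.mem_powerset.2 hle)
    have h4 : Multiset.card π = Multiset.card μ.parts := by rw [← h2, Multiset.card_map]
    rw [Multiset.count_nsmul, ← h4]
    calc π.count B ≤ Multiset.card π := Multiset.count_le_card _ _
      _ = Multiset.card π * 1 := (mul_one _).symm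
      _ ≤ _ := Nat.mul_le_mul_left _ h3
  · rw [Multiset.count_eq_zero_of_notMem hB]
    exact Nat.zero_le _

noncomputable instance : Fintype (MultisetPartition S μ) := Fintype.ofFinite _

/-- The restriction `π|_a` of `π` to the blocks of size `a`. -/
def restrict (π : MultisetPartition S μ) (a : ℕ) : Multiset (Multiset ℕ) :=
  π.1.filter fun B => Multiset.card B = a

theorem card_restrict (π : MultisetPartition S μ) (a : ℕ) :
    Multiset.card (π.restrict a) = μ.parts.count a := by
  rw [← π.2.2, Multiset.count_map, restrict]
  congr 1
  exact Multiset.filter_congr fun x _ => eq_comm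

end MultisetPartition

/-- The partition `type(σ)` of `m` whose parts are the multiplicities of the distinct elements of
a multiset `σ` with `m` elements. -/
def multisetType {α : Type*} [DecidableEq α] {m : ℕ} (σ : Multiset α)
    (hm : Multiset.card σ = m) : m.Partition where
  parts := σ.dedup.map σ.count
  parts_pos := by
    intro i hi
    obtain ⟨B, hB, rfl⟩ := Multiset.mem_map.1 hi
    exact Multiset.count_pos.2 (Multiset.mem_dedup.1 hB)
  parts_sum := by
    rw [← hm]
    exact Multiset.toFinset_sum_count_eq σ

/-! ### Counting lemmas for functions and group actions -/

/-! Everything reduces to counting words, i.e. arrangements of a multiset `σ` along a finite set of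
positions. The permutation module on words has as character the number of fixed words, and its
Frobenius image is `h_{type(σ)}` (`SymFun.h_multisetType`; for `h_λ` itself, `frob_wordRep`). Indeed
the coefficient of `x^m` in `p_{cyc(w)}` counts words of content `m` fixed by `w`
(`SymFun.coeff_p_cyc`), so summing over `w` counts fixed pairs of words. Burnside turns this into
`n!` times the number of multisets of letter pairs, and these are the ways to build `x^m` from a
product of `h`'s.

Existence of `ψ_μ`: `η_μ / |𝔖_μ|` is a projection, so the character of `η_μ V` at `u` is the average
of `χ_V(w ι_μ(u))` over `w ∈ 𝔖_μ` (`character_etaRep`), which is linear in `χ_V`. The power sums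
form a basis by triangularity, so `χ_V` is itself a linear function of `Frob(V)` (`classFun_frob`).
Uniqueness: the `h_λ` are Frobenius images and determine a linear map (`linearMap_eq_of_h`).

The formula: take `V` to be the functions on words of content `S`. The `𝔖_μ`-orbits of words are the
tuples of block contents, and `ι_μ(u)` permutes them. An orbit count twisted by `ι_μ(u)`
(`sum_card_smul_eq_self`) shows that the character of `η_μ V` at `u` is the number of tuples fixed
by `u`. Forgetting the order of a tuple leaves a multiset partition `π` of shape `μ`. The tuples
over `π` are families of words of contents `π|_{a_i}`, one for each part size (`card_fixedTuple`),
so the first fact, applied in every tensor factor, gives the summand of `π`. -/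

theorem exists_perm_of_map_univ_eq {X Y : Type*} [Fintype X] {f g : X → Y}
    (h : Finset.univ.val.map f = Finset.univ.val.map g) :
    ∃ w : Equiv.Perm X, ∀ x, g (w x) = f x := by
  classical
  have hcard : ∀ y, Nonempty ({x // f x = y} ≃ {x // g x = y}) := by
    intro y
    refine Fintype.card_eq.1 ?_
    have h2 := congrArg (Multiset.count y) h
    rw [Multiset.count_map, Multiset.count_map] at h2
    rw [Fintype.card_subtype, Fintype.card_subtype]
    simpa [Finset.card, eq_comm] using h2
  exact ⟨Equiv.ofFiberEquiv fun y => (hcard y).some, fun x => Equiv.ofFiberEquiv_map _ x⟩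

theorem map_univ_comp_perm {X Y : Type*} [Fintype X] (f : X → Y) (w : Equiv.Perm X) :
    (Finset.univ.val.map fun x => f (w x)) = Finset.univ.val.map f := by
  conv_rhs => rw [← Multiset.map_univ_val_equiv w, Multiset.map_map]
  rfl

theorem exists_map_univ_eq {X Y : Type*} [Fintype X] (τ : Multiset Y)
    (h : Multiset.card τ = Fintype.card X) : ∃ f : X → Y, Finset.univ.val.map f = τ := by
  induction τ using Quotient.inductionOn with
  | h l =>
    have hl : Fintype.card X = Fintype.card (Fin l.length) := by simpa using h.symm
    obtain ⟨e⟩ := Fintype.card_eq.1 hl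
    refine ⟨fun x => l.get (e x), ?_⟩
    have : (Finset.univ.val.map fun x => l.get (e x)) =
        (Finset.univ.val.map e).map l.get := by rw [Multiset.map_map]; rfl
    rw [this, Multiset.map_univ_val_equiv, Fin.univ_val_map, List.ofFn_get]
    rfl

/-- The number of orbits fixed by a map `s` that is compatible with the orbits, where the orbits
are given as the values of an invariant `inv`. -/
theorem sum_card_smul_eq_self {G T I : Type*} [Group G] [Fintype G] [MulAction G T] [Finite T]
    (inv : T → I) (hinv : ∀ x y, inv x = inv y ↔ ∃ g : G, g • x = y)
    (s : T → T) (s' : I → I) (hs : ∀ x, inv (s x) = s' (inv x)) :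
    ∑ g : G, Nat.card {x : T // g • s x = x} =
      Nat.card G * Nat.card {i : I // i ∈ Set.range inv ∧ s' i = i} := by
  classical
  have := Fintype.ofFinite T
  have hfin : Finite {i : I // i ∈ Set.range inv ∧ s' i = i} :=
    Finite.of_injective (fun i => (⟨i.1, i.2.1⟩ : Set.range inv)) fun a b h => by
      ext1
      simpa using h
  have := Fintype.ofFinite {i : I // i ∈ Set.range inv ∧ s' i = i}
  -- all transporters into a given orbit have the same size as the stabilizer
  have htrans : ∀ x y z : T, inv x = inv y → inv z = inv y →
      Nat.card {g : G // g • x = y} = Nat.card {g : G // g • z = y} := by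
    intro x y z hxy hzy
    obtain ⟨k, hk⟩ := (hinv z x).1 (hzy.trans hxy.symm)
    refine Nat.card_congr ⟨fun g => ⟨g.1 * k, by rw [mul_smul, hk, g.2]⟩,
      fun g => ⟨g.1 * k⁻¹, by rw [mul_smul, ← hk, inv_smul_smul, g.2]⟩, ?_, ?_⟩
    · intro g; ext1; simp
    · intro g; ext1; simp
  have horb : ∀ i : {i : I // i ∈ Set.range inv ∧ s' i = i},
      Nat.card {q : {x : T // inv x = i.1} × G // q.2 • s q.1.1 = q.1.1} = Nat.card G := by
    rintro ⟨i, ⟨x₀, hx₀⟩, hi⟩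
    have h1 : Nat.card {q : {x : T // inv x = i} × G // q.2 • s q.1.1 = q.1.1} =
        Nat.card (Σ x : {x : T // inv x = i}, {g : G // g • s x.1 = x.1}) :=
      Nat.card_congr ⟨fun q => ⟨q.1.1, q.1.2, q.2⟩, fun q => ⟨(q.1, q.2.1), q.2.2⟩,
        fun q => rfl, fun q => rfl⟩
    -- The transporters from a fixed base point `x₀` to the points of its orbit partition `G`. As
    -- `s' i = i`, the point `s x` lies in the same orbit, so its transporters to `x` are equally
    -- numerous.
    have h2 : Nat.card G = Nat.card (Σ x : {x : T // inv x = i}, {g : G // g • x₀ = x.1}) := by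
      refine Nat.card_congr ⟨fun g => ⟨⟨g • x₀, ?_⟩, g, rfl⟩, fun q => q.2.1, fun g => rfl, ?_⟩
      · rw [← hx₀]
        exact ((hinv _ _).2 ⟨g, rfl⟩).symm
      · rintro ⟨⟨x, hx⟩, g, hg⟩
        simp only at hg
        subst hg
        rfl
    rw [h1, h2, Nat.card_sigma, Nat.card_sigma]
    refine Finset.sum_congr rfl fun x _ => htrans _ _ _ ?_ ?_
    · rw [hs, x.2, hi]
    · rw [hx₀, x.2]
  -- Orbits not fixed by `s'` contribute nothing: `g • s x = x` forces `s x` and `x` into one orbit.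
  have h3 : ∑ g : G, Nat.card {x : T // g • s x = x} =
      Nat.card (Σ i : {i : I // i ∈ Set.range inv ∧ s' i = i},
        {q : {x : T // inv x = i.1} × G // q.2 • s q.1.1 = q.1.1}) := by
    rw [← Nat.card_sigma]
    refine Nat.card_congr ⟨fun q => ⟨⟨inv q.2.1, ⟨_, rfl⟩, ?_⟩, ⟨(⟨q.2.1, rfl⟩, q.1), q.2.2⟩⟩,
      fun q => ⟨q.2.1.2, q.2.1.1.1, q.2.2⟩, fun q => rfl, ?_⟩
    · rw [← hs]
      exact (hinv _ _).2 ⟨q.1, q.2.2⟩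
    · rintro ⟨⟨i, hi, hi'⟩, ⟨⟨⟨x, hx⟩, g⟩, hq⟩⟩
      simp only at hx
      subst hx
      rfl
  rw [h3, Nat.card_sigma, Finset.sum_congr rfl fun i _ => horb i]
  rw [Finset.sum_const, Finset.card_univ, smul_eq_mul, mul_comm,
    Nat.card_eq_fintype_card (α := {i : I // i ∈ Set.range inv ∧ s' i = i})]

/-- The words with letters at the positions in `X` and with content `σ`. -/
def Word (X : Type*) [Fintype X] {α : Type*} (σ : Multiset α) : Type _ :=
  {f : X → α // Finset.univ.val.map f = σ}

namespace Word

variable {X : Type*} [Fintype X] {α : Type*} {σ : Multiset α}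

instance : MulAction (Equiv.Perm X) (Word X σ) where
  smul w f := ⟨fun x => f.1 (w⁻¹ x), (map_univ_comp_perm _ _).trans f.2⟩
  one_smul f := rfl
  mul_smul v w f := Subtype.ext (funext fun x => congrArg f.1 (by simp [mul_inv_rev]))

theorem smul_val (w : Equiv.Perm X) (f : Word X σ) (x : X) : (w • f).1 x = f.1 (w⁻¹ x) := rfl

theorem smul_eq_iff (w : Equiv.Perm X) (f g : Word X σ) :
    w • f = g ↔ ∀ x, g.1 (w x) = f.1 x := by
  constructor
  · rintro rfl x
    simp [smul_val]
  · intro h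
    refine Subtype.ext (funext fun x => ?_)
    simp [smul_val, ← h]

theorem mem (f : Word X σ) (x : X) : f.1 x ∈ σ := by
  have := Multiset.mem_map_of_mem f.1 (Finset.mem_univ_val x)
  rwa [f.2] at this

instance : Finite (Word X σ) := by
  classical
  refine Finite.of_injective
    (fun f : Word X σ => fun x => (⟨f.1 x, Multiset.mem_toFinset.2 (f.mem x)⟩ : σ.toFinset)) ?_
  intro f g h
  refine Subtype.ext (funext fun x => ?_)
  exact congrArg Subtype.val (congrFun h x)

variable (σ) in
/-- The number of words of content `σ` that are fixed by the permutation `w`. -/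
noncomputable def fixedCount (w : Equiv.Perm X) : ℕ := Nat.card {f : Word X σ // w • f = f}

end Word

/-! ### Coefficients of products of complete symmetric functions and of power sums -/

-- Every factor is a sum of distinct monomials with coefficient one, so expanding the product
-- amounts to choosing one monomial per factor. Both `hSeries` and `pSeries` are of this kind.
open Classical in
theorem coeff_prod_eq_card {F : Type*} [Field F] {ι : Type*} [Fintype ι] {S : ι → Type*}
    (f : ι → MvPowerSeries ℕ F) (wt : ∀ i, S i → ℕ →₀ ℕ) (hwt : ∀ i, Function.Injective (wt i))
    (hf : ∀ i m, MvPowerSeries.coeff m (f i) = if m ∈ Set.range (wt i) then 1 else 0)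
    (m : ℕ →₀ ℕ) :
    MvPowerSeries.coeff m (∏ i, f i) = (Nat.card {c : ∀ i, S i // ∑ i, wt i (c i) = m} : F) := by
  rw [MvPowerSeries.coeff_prod]
  have h1 : ∀ l : ι →₀ ℕ →₀ ℕ, ∏ i, MvPowerSeries.coeff (l i) (f i) =
      if ∀ i, l i ∈ Set.range (wt i) then 1 else 0 := by
    intro l
    simp_rw [hf]
    rw [Finset.prod_boole]
    simp only [Finset.mem_univ, true_implies]
  rw [Finset.sum_congr rfl fun l _ => h1 l, Finset.sum_boole]
  congr 1
  rw [← Nat.subtype_card (p := fun l : ι →₀ ℕ →₀ ℕ => ∑ i, l i = m ∧ ∀ i, l i ∈ Set.range (wt i))]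
  · symm
    refine Nat.card_congr (Equiv.ofBijective (fun c => ⟨Finsupp.equivFunOnFinite.symm
      fun i => wt i (c.1 i), c.2, fun i => ⟨c.1 i, rfl⟩⟩) ⟨?_, ?_⟩)
    · intro c d h
      have h1 := congrArg (fun l => (l.1 : ι → ℕ →₀ ℕ)) h
      exact Subtype.ext (funext fun i => hwt i (congrFun h1 i))
    · rintro ⟨l, hl, hl'⟩
      choose c hc using id hl'
      refine ⟨⟨c, ?_⟩, ?_⟩
      · simp_rw [hc]
        exact hl
      · ext1
        ext1 i
        exact hc i
  · intro l
    simp [Finset.mem_finsuppAntidiag]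

open Classical in
theorem coeff_prod_hSeries {F : Type*} [Field F] {ι : Type*} [Fintype ι] (k : ι → ℕ)
    (m : ℕ →₀ ℕ) : MvPowerSeries.coeff m (∏ i, SymFun.hSeries F (k i)) =
      (Nat.card {c : ∀ i, {d : ℕ →₀ ℕ // d.degree = k i} // ∑ i, (c i).1 = m} : F) :=
  coeff_prod_eq_card _ (fun i => Subtype.val) (fun i => Subtype.val_injective)
    (fun i d => by
      change (if d.degree = k i then 1 else 0) = _
      simp) m

-- Positivity of the exponents keeps the monomials `x_j ^ k` distinct for distinct `j`.
open Classical in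
theorem coeff_prod_pSeries {F : Type*} [Field F] {ι : Type*} [Fintype ι] (k : ι → ℕ)
    (hk : ∀ i, 0 < k i) (m : ℕ →₀ ℕ) : MvPowerSeries.coeff m (∏ i, SymFun.pSeries F (k i)) =
      (Nat.card {c : ι → ℕ // ∑ i, Finsupp.single (c i) (k i) = m} : F) :=
  coeff_prod_eq_card _ (fun i j => Finsupp.single j (k i))
    (fun i => Finsupp.single_left_injective (hk i).ne')
    (fun i d => by simp only [Set.mem_range, eq_comm (b := d)]; rfl) m

namespace Equiv.Perm

variable {X : Type*} [Fintype X] [DecidableEq X] (w : Equiv.Perm X)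

open Classical in
/-- The parts of the cycle type are the sizes of the orbits. -/
theorem partition_parts_eq_map_card :
    w.partition.parts = (Finset.univ : Finset (Quotient (SameCycle.setoid w))).val.map
      fun q => (Finset.univ.filter fun x => Quotient.mk (SameCycle.setoid w) x = q).card := by
  set fib : Quotient (SameCycle.setoid w) → Finset X :=
    fun q => Finset.univ.filter fun x => Quotient.mk (SameCycle.setoid w) x = q with hfib
  have hmem : ∀ x y, y ∈ fib (Quotient.mk _ x) ↔ w.SameCycle x y := by
    intro x y
    simp only [hfib, Finset.mem_filter, Finset.mem_univ, true_and]
    rw [Quotient.eq]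
    exact sameCycle_comm
  have hinj : Function.Injective fib := by
    intro p q
    induction p using Quotient.inductionOn with | h x => ?_
    induction q using Quotient.inductionOn with | h y => ?_
    intro h
    have : y ∈ fib (Quotient.mk _ x) := by
      rw [h, hmem]
    exact Quotient.sound ((hmem _ _).1 this)
  -- The orbits are the supports of the nontrivial cycles together with the singletons of fixed
  -- points, matching the two summands in the cycle-type partition.
  have himg : Finset.univ.image fib =
      w.cycleFactorsFinset.image support ∪ (w.supportᶜ).image fun x => {x} := by
    ext s
    simp only [Finset.mem_image, Finset.mem_univ, true_and, Finset.mem_union, Finset.mem_compl]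
    constructor
    · rintro ⟨q, rfl⟩
      induction q using Quotient.inductionOn with | h x => ?_
      by_cases hx : x ∈ w.support
      · refine Or.inl ⟨w.cycleOf x, cycleOf_mem_cycleFactorsFinset_iff.2 hx, ?_⟩
        ext y
        rw [mem_support_cycleOf_iff, hmem]
        exact and_iff_left hx
      · refine Or.inr ⟨x, hx, ?_⟩
        ext y
        rw [hmem, Finset.mem_singleton]
        rw [notMem_support] at hx
        constructor
        · rintro rfl
          exact SameCycle.refl _ _
        · intro h
          exact (h.eq_of_left hx).symm
    · rintro (⟨c, hc, rfl⟩ | ⟨x, hx, rfl⟩)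
      · obtain ⟨x, hx⟩ := (mem_cycleFactorsFinset_iff.1 hc).1.nonempty_support
        have hcx := cycle_is_cycleOf hx hc
        refine ⟨Quotient.mk _ x, ?_⟩
        ext y
        rw [hmem, hcx, mem_support_cycleOf_iff]
        exact (and_iff_left (cycleOf_mem_cycleFactorsFinset_iff.1 (hcx ▸ hc))).symm
      · refine ⟨Quotient.mk _ x, ?_⟩
        ext y
        rw [hmem, Finset.mem_singleton]
        rw [notMem_support] at hx
        constructor
        · intro h
          exact (h.eq_of_left hx).symm
        · rintro rfl
          exact SameCycle.refl _ _
  have hdisj : _root_.Disjoint (w.cycleFactorsFinset.image support)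
      ((w.supportᶜ).image fun x => ({x} : Finset X)) := by
    rw [Finset.disjoint_left]
    intro s hs hs'
    obtain ⟨c, hc, rfl⟩ := Finset.mem_image.1 hs
    obtain ⟨x, -, hx⟩ := Finset.mem_image.1 hs'
    have := (mem_cycleFactorsFinset_iff.1 hc).1.two_le_card_support
    rw [← hx] at this
    simp at this
  have hsupp : Set.InjOn (support : Equiv.Perm X → Finset X) w.cycleFactorsFinset := by
    intro c hc d hd h
    obtain ⟨x, hx⟩ := (mem_cycleFactorsFinset_iff.1 hc).1.nonempty_support
    rw [cycle_is_cycleOf hx hc, cycle_is_cycleOf (h ▸ hx) hd]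
  have h1 : (Finset.univ.val.map fun q => (fib q).card) =
      (Finset.univ.image fib).val.map Finset.card := by
    rw [Finset.image_val_of_injOn hinj.injOn, Multiset.map_map]
    rfl
  rw [h1, himg, parts_partition, cycleType_def, ← Finset.disjUnion_eq_union _ _ hdisj,
    Finset.disjUnion_val, Multiset.map_add, Finset.image_val_of_injOn hsupp,
    Finset.image_val_of_injOn (Finset.singleton_injective.injOn), Multiset.map_map,
    Multiset.map_map]
  congr 1
  simp [Finset.card_compl]

end Equiv.Perm

open Classical in
/-- The coefficients of `p_{cyc(w)}` count the words fixed by `w`. -/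
theorem SymFun.coeff_p_cyc (F : Type*) [Field F] {X : Type*} [Fintype X] [DecidableEq X] {n : ℕ}
    (hX : Fintype.card X = n) (w : Equiv.Perm X) (m : ℕ →₀ ℕ) :
    MvPowerSeries.coeff m (SymFun.p F (cyc hX w)).1 =
      (Word.fixedCount (Finsupp.toMultiset m) w : F) := by
  let st := Equiv.Perm.SameCycle.setoid w
  let k : Quotient st → ℕ :=
    fun q => (Finset.univ.filter fun x => Quotient.mk st x = q).card
  have hk : ∀ q, 0 < k q := by
    intro q
    induction q using Quotient.inductionOn with | h x => ?_
    exact Finset.card_pos.2 ⟨x, by simp⟩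
  have h1 : (SymFun.p F (cyc hX w)).1 = ∏ q : Quotient st, SymFun.pSeries F (k q) := by
    have : (cyc hX w).parts = Finset.univ.val.map k := w.partition_parts_eq_map_card
    change ((cyc hX w).parts.map (SymFun.pSeries F)).prod = _
    rw [this, Multiset.map_map]
    rfl
  have hsum : ∀ c : Quotient st → ℕ, ∑ q, Finsupp.single (c q) (k q) =
      Multiset.toFinsupp (Finset.univ.val.map fun x : X => c (Quotient.mk st x)) := by
    intro c
    have h2 : Multiset.toFinsupp (Finset.univ.val.map fun x : X => c (Quotient.mk st x)) =
        ∑ x : X, Finsupp.single (c (Quotient.mk st x)) 1 := by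
      rw [← Multiset.sum_map_singleton (Finset.univ.val.map _), Multiset.map_map,
        map_multiset_sum, Multiset.map_map, Finset.sum]
      simp [Function.comp_def]
    rw [h2, ← Finset.sum_fiberwise Finset.univ (fun x => Quotient.mk st x)]
    refine Finset.sum_congr rfl fun q _ => ?_
    rw [Finset.sum_congr rfl (g := fun _ => Finsupp.single (c q) 1)]
    · rw [Finset.sum_const, Finsupp.smul_single, smul_eq_mul, mul_one]
    · intro x hx
      rw [(Finset.mem_filter.1 hx).2]
  -- Choosing a variable for each cycle is the same as choosing a word constant on cycles, i.e. a
  -- word fixed by `w`.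
  rw [h1, coeff_prod_pSeries k hk, Word.fixedCount]
  congr 1
  refine Nat.card_congr (Equiv.ofBijective (fun c => ⟨⟨fun x => c.1 (Quotient.mk st x), ?_⟩,
    (Word.smul_eq_iff _ _ _).2 fun x => ?_⟩) ⟨?_, ?_⟩)
  · have := c.2
    rw [hsum] at this
    exact Multiset.toFinsupp.eq_symm_apply.2 this
  · exact congrArg c.1 (Quotient.sound (Equiv.Perm.sameCycle_apply_left.2 (.refl _ _)))
  · intro c d h
    have h2 := congrArg (fun f => f.1.1) h
    refine Subtype.ext (funext fun q => ?_)
    induction q using Quotient.inductionOn with | h x => ?_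
    exact congrFun h2 x
  · rintro ⟨f, hf⟩
    rw [Word.smul_eq_iff] at hf
    have hinv : ∀ x y, w.SameCycle x y → f.1 x = f.1 y := by
      rintro x y ⟨i, rfl⟩
      induction i using Int.induction_on with
      | zero => rfl
      | succ i ih => rw [add_comm, zpow_add, zpow_one, Equiv.Perm.mul_apply, hf, ih]
      | pred i ih =>
        rw [ih, sub_eq_neg_add, zpow_add, Equiv.Perm.mul_apply, zpow_neg_one]
        rw [← hf (w⁻¹ _)]
        simp
    refine ⟨⟨Quotient.lift f.1 hinv, ?_⟩, rfl⟩
    rw [hsum]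
    exact Multiset.toFinsupp.eq_symm_apply.1 f.2

/-! ### The complete homogeneous symmetric functions in terms of power sums -/

section Pairs

variable {α : Type*} [DecidableEq α] {σ : Multiset α}

/-- The multiset of pairs `(b, i)`, where `(b, i)` occurs `c b i` times. -/
noncomputable def pairMultiset (c : σ.toFinset → ℕ →₀ ℕ) : Multiset (α × ℕ) :=
  ∑ b, (Finsupp.toMultiset (c b)).map (Prod.mk b.1)

theorem count_pairMultiset (c : σ.toFinset → ℕ →₀ ℕ) (b : σ.toFinset) (i : ℕ) :
    (pairMultiset c).count (b.1, i) = c b i := by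
  rw [pairMultiset, Multiset.count_sum', Finset.sum_eq_single b]
  · rw [Multiset.count_map_eq_count' _ _ (Prod.mk_right_injective _), Finsupp.count_toMultiset]
  · intro b' _ hb
    refine Multiset.count_eq_zero_of_notMem fun h => hb ?_
    obtain ⟨j, -, hj⟩ := Multiset.mem_map.1 h
    exact Subtype.ext (congrArg Prod.fst hj)
  · simp

theorem map_fst_pairMultiset (c : σ.toFinset → ℕ →₀ ℕ) (hc : ∀ b, (c b).degree = σ.count b.1) :
    (pairMultiset c).map Prod.fst = σ := by
  have h1 : ∀ b, ((Finsupp.toMultiset (c b)).map (Prod.mk b.1)).map Prod.fst =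
      σ.count b.1 • {b.1} := by
    intro b
    rw [Multiset.map_map, Multiset.nsmul_singleton, ← hc b]
    have : (Prod.fst ∘ Prod.mk b.1 : ℕ → α) = Function.const _ b.1 := rfl
    rw [this, Multiset.map_const, Finsupp.card_toMultiset]
    rfl
  rw [pairMultiset, ← Multiset.coe_mapAddMonoidHom, map_sum]
  simp_rw [Multiset.coe_mapAddMonoidHom, h1]
  rw [Finset.sum_coe_sort σ.toFinset fun b => σ.count b • ({b} : Multiset α)]
  exact Multiset.toFinset_sum_count_nsmul_eq σ

theorem map_snd_pairMultiset (c : σ.toFinset → ℕ →₀ ℕ) :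
    (pairMultiset c).map Prod.snd = Finsupp.toMultiset (∑ b, c b) := by
  rw [pairMultiset, ← Multiset.coe_mapAddMonoidHom, map_sum, map_sum]
  refine Finset.sum_congr rfl fun b _ => ?_
  rw [Multiset.coe_mapAddMonoidHom, Multiset.map_map]
  exact Multiset.map_id _

theorem exists_pairMultiset_eq (τ : Multiset (α × ℕ)) (hτ : τ.map Prod.fst = σ) :
    ∃ c : σ.toFinset → ℕ →₀ ℕ, (∀ b, (c b).degree = σ.count b.1) ∧ pairMultiset c = τ := by
  refine ⟨fun b => Multiset.toFinsupp ((τ.filter fun q => b.1 = q.1).map Prod.snd), ?_, ?_⟩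
  · intro b
    have h1 := congrArg (Multiset.count b.1) hτ
    rw [Multiset.count_map, ← Multiset.card_map Prod.snd, ← Multiset.toFinsupp_sum_eq] at h1
    exact h1
  · ext ⟨b, i⟩
    by_cases hb : b ∈ σ.toFinset
    · rw [count_pairMultiset _ ⟨b, hb⟩, Multiset.toFinsupp_apply, Multiset.count_map,
        Multiset.filter_filter, Multiset.count, Multiset.countP_eq_card_filter]
      congr 1
      refine Multiset.filter_congr fun q _ => ?_
      rw [Prod.ext_iff, and_comm]
    · rw [Multiset.count_eq_zero_of_notMem, Multiset.count_eq_zero_of_notMem]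
      · intro h
        exact hb (Multiset.mem_toFinset.2 (hτ ▸ Multiset.mem_map_of_mem Prod.fst h))
      · intro h
        rw [pairMultiset, Multiset.mem_sum] at h
        obtain ⟨b', -, hb'⟩ := h
        obtain ⟨j, -, hj⟩ := Multiset.mem_map.1 hb'
        have h2 : b'.1 = b := congrArg Prod.fst hj
        exact hb (h2 ▸ b'.2)

-- The left side is a coefficient of `∏ h_{σ.count b}`: for each letter `b` a monomial of degree its
-- multiplicity. Reading that monomial as the list of partners of `b` gives a multiset of pairs with
-- prescribed marginals.
variable (σ) in
theorem card_pairs_eq (m : ℕ →₀ ℕ) :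
    Nat.card {c : ∀ b : σ.toFinset, {d : ℕ →₀ ℕ // d.degree = σ.count b.1} // ∑ b, (c b).1 = m} =
      Nat.card {τ : Multiset (α × ℕ) //
        τ.map Prod.fst = σ ∧ τ.map Prod.snd = Finsupp.toMultiset m} := by
  refine Nat.card_congr (Equiv.ofBijective (fun c => ⟨pairMultiset fun b => (c.1 b).1,
    map_fst_pairMultiset _ fun b => (c.1 b).2, by rw [map_snd_pairMultiset, c.2]⟩) ⟨?_, ?_⟩)
  · intro c d h
    refine Subtype.ext (funext fun b => Subtype.ext (Finsupp.ext fun i => ?_))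
    rw [← count_pairMultiset (fun b => (c.1 b).1) b i, ← count_pairMultiset (fun b => (d.1 b).1) b i]
    exact congrArg (Multiset.count (b.1, i)) (Subtype.ext_iff.1 h)
  · rintro ⟨τ, hτ, hτ'⟩
    obtain ⟨c, hc, rfl⟩ := exists_pairMultiset_eq τ hτ
    refine ⟨⟨fun b => ⟨c b, hc b⟩, ?_⟩, rfl⟩
    rw [map_snd_pairMultiset] at hτ'
    exact Multiset.toFinsupp.symm.injective hτ'

end Pairs

/-- Burnside's lemma for the diagonal action on pairs of words. The multiset of pairs of letters at
common positions is a complete invariant of an orbit. -/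
theorem sum_fixedCount_mul {α X : Type*} [Fintype X] [DecidableEq X] {σ : Multiset α}
    (hσ : Multiset.card σ = Fintype.card X) (m : ℕ →₀ ℕ) :
    ∑ w : Equiv.Perm X, Word.fixedCount σ w * Word.fixedCount (Finsupp.toMultiset m) w =
      (Fintype.card X).factorial * Nat.card {τ : Multiset (α × ℕ) //
        τ.map Prod.fst = σ ∧ τ.map Prod.snd = Finsupp.toMultiset m} := by
  have key := sum_card_smul_eq_self (G := Equiv.Perm X)
    (T := Word X σ × Word X (Finsupp.toMultiset m))
    (fun f => Finset.univ.val.map fun x => (f.1.1 x, f.2.1 x)) ?_ id id fun _ => rfl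
  · rw [Nat.card_perm, Nat.card_eq_fintype_card] at key
    convert key using 1
    · refine Finset.sum_congr rfl fun w _ => ?_
      rw [Word.fixedCount, Word.fixedCount, ← Nat.card_prod]
      refine Nat.card_congr ⟨fun q => ⟨(q.1.1, q.2.1), Prod.ext q.1.2 q.2.2⟩,
        fun q => (⟨q.1.1, congrArg Prod.fst q.2⟩, ⟨q.1.2, congrArg Prod.snd q.2⟩),
        fun q => rfl, fun q => rfl⟩
    · congr 1
      refine Nat.card_congr (Equiv.subtypeEquivRight fun τ => ?_)
      simp only [id, and_true, Set.mem_range]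
      constructor
      · rintro ⟨h1, h2⟩
        obtain ⟨f, rfl⟩ := exists_map_univ_eq (X := X) τ (by rw [← hσ, ← h1, Multiset.card_map])
        exact ⟨(⟨fun x => (f x).1, by rw [← h1, Multiset.map_map]; rfl⟩,
          ⟨fun x => (f x).2, by rw [← h2, Multiset.map_map]; rfl⟩), rfl⟩
      · rintro ⟨f, rfl⟩
        rw [Multiset.map_map, Multiset.map_map]
        exact ⟨f.1.2, f.2.2⟩
  · intro f g
    constructor
    · intro h
      obtain ⟨w, hw⟩ := exists_perm_of_map_univ_eq h
      exact ⟨w, Prod.ext ((Word.smul_eq_iff _ _ _).2 fun x => congrArg Prod.fst (hw x))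
        ((Word.smul_eq_iff _ _ _).2 fun x => congrArg Prod.snd (hw x))⟩
    · rintro ⟨w, rfl⟩
      exact (map_univ_comp_perm (fun x => (f.1.1 x, f.2.1 x)) w⁻¹).symm

/-- The complete homogeneous symmetric function `h_{type(σ)}` is the Frobenius image of the
permutation character on the words of content `σ`. -/
theorem SymFun.h_multisetType (F : Type*) [Field F] [CharZero F] {α X : Type*} [DecidableEq α]
    [Fintype X] [DecidableEq X] {σ : Multiset α} {n : ℕ}
    (hX : Fintype.card X = n) (hσ : Multiset.card σ = n) :
    SymFun.h F (multisetType σ hσ) = ((n.factorial : ℕ) : F)⁻¹ •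
      ∑ w : Equiv.Perm X, (Word.fixedCount σ w : F) • SymFun.p F (cyc hX w) := by
  have hn : ((n.factorial : ℕ) : F) ≠ 0 := Nat.cast_ne_zero.2 n.factorial_ne_zero
  rw [eq_inv_smul_iff₀ hn]
  ext m
  have h1 : (SymFun.h F (multisetType σ hσ)).1 =
      ∏ b : σ.toFinset, SymFun.hSeries F (σ.count b.1) := by
    rw [Finset.prod_coe_sort σ.toFinset fun b => SymFun.hSeries F (σ.count b)]
    change ((σ.dedup.map σ.count).map (SymFun.hSeries F)).prod = _
    rw [Multiset.map_map]
    rfl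
  have h2 : (∑ w : Equiv.Perm X, (Word.fixedCount σ w : F) • SymFun.p F (cyc hX w)).1 =
      ∑ w : Equiv.Perm X, (Word.fixedCount σ w : F) • (SymFun.p F (cyc hX w)).1 := by
    rw [AddSubmonoidClass.coe_finsetSum]
    rfl
  rw [h2, map_sum, Submodule.coe_smul, h1, map_smul, coeff_prod_hSeries, card_pairs_eq]
  simp_rw [map_smul, SymFun.coeff_p_cyc, smul_eq_mul]
  rw [← Nat.cast_mul, ← hX, ← sum_fixedCount_mul (hσ.trans hX.symm), Nat.cast_sum]
  simp_rw [Nat.cast_mul]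

/-! ### The permutation module on words -/

section PermutationModule

variable (F : Type*) [Field F] {G T : Type*} [Group G] [MulAction G T]

/-- The permutation module of functions on a `G`-set. -/
def funRep : Representation F G (T → F) where
  toFun g := LinearMap.funLeft F F fun x : T => g⁻¹ • x
  map_one' := by
    ext φ x
    simp
  map_mul' g h := by
    ext φ x
    simp [LinearMap.funLeft_apply, mul_smul]

theorem character_funRep [Finite T] (g : G) :
    (funRep F (T := T)).character g = (Nat.card {x : T // g • x = x} : F) := by
  classical
  have := Fintype.ofFinite T
  rw [Representation.character, LinearMap.trace_eq_matrix_trace F (Pi.basisFun F T), Matrix.trace]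
  have h1 : ∀ x : T, (LinearMap.toMatrix (Pi.basisFun F T) (Pi.basisFun F T)
      (funRep F g)).diag x = if g • x = x then 1 else 0 := by
    intro x
    rw [Matrix.diag_apply, LinearMap.toMatrix_apply]
    simp only [funRep, Pi.basisFun_apply, Pi.basisFun_repr, MonoidHom.coe_mk, OneHom.coe_mk,
      LinearMap.funLeft_apply, Pi.single_apply]
    congr 1
    rw [eq_iff_iff, inv_smul_eq_iff, eq_comm]
  rw [Finset.sum_congr rfl fun x _ => h1 x, Finset.sum_boole]
  congr 1
  exact (Nat.subtype_card _ (by simp)).symm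

theorem character_wordRep {X : Type*} [Fintype X] {α : Type*} (σ : Multiset α)
    (w : Equiv.Perm X) : (funRep F (T := Word X σ)).character w = (Word.fixedCount σ w : F) :=
  character_funRep F w

end PermutationModule

/-! ### The words of content `{1^{λ_1}, 2^{λ_2}, …}` -/

section Content

variable {n : ℕ} (lam : n.Partition)

theorem count_contentMultiset (i : Fin lam.length) :
    (contentMultiset lam).count (i.1 + 1) = lam.part i := by
  rw [contentMultiset, Multiset.count_sum', Finset.sum_eq_single i]
  · rw [Multiset.count_replicate_self]
  · intro j _ hj
    rw [Multiset.count_replicate, if_neg]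
    intro h
    exact hj (Fin.ext (by omega))
  · simp

theorem card_contentMultiset : Multiset.card (contentMultiset lam) = n := by
  rw [contentMultiset, Multiset.card_sum]
  simp [lam.sum_part]

theorem part_pos (i : Fin lam.length) : 0 < lam.part i :=
  lam.parts_pos (by rw [← lam.map_part]; exact Multiset.mem_map_of_mem _ (Finset.mem_univ_val i))

theorem toFinset_contentMultiset :
    (contentMultiset lam).toFinset = Finset.univ.image fun i : Fin lam.length => i.1 + 1 := by
  ext x
  rw [Multiset.mem_toFinset, contentMultiset, Multiset.mem_sum]
  simp only [Finset.mem_image]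
  refine exists_congr fun i => and_congr_right fun _ => ?_
  rw [Multiset.mem_replicate, eq_comm (a := x)]
  exact and_iff_right (part_pos lam i).ne'

theorem map_count_contentMultiset :
    (contentMultiset lam).toFinset.val.map (contentMultiset lam).count = lam.parts := by
  rw [toFinset_contentMultiset, Finset.image_val_of_injOn, Multiset.map_map, ← lam.map_part]
  · exact Multiset.map_congr rfl fun i _ => count_contentMultiset lam i
  · intro i _ j _ h
    exact Fin.ext (by simpa using h)

theorem multisetType_contentMultiset :
    multisetType (contentMultiset lam) (card_contentMultiset lam) = lam :=
  Nat.Partition.ext (map_count_contentMultiset lam)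

theorem frob_wordRep (F : Type*) [Field F] [CharZero F] :
    frob (funRep F (T := Word (Fin n) (contentMultiset lam))) = SymFun.h F lam := by
  conv_rhs => rw [← multisetType_contentMultiset lam]
  rw [SymFun.h_multisetType F (Fintype.card_fin n), frob]
  simp_rw [character_wordRep]

end Content

/-! ### The power sums form a basis of `Λ_n` -/

namespace SymFun

variable (F : Type*) [Field F] {n : ℕ}

/-- The exponent `x_1 ^ λ_1 x_2 ^ λ_2 ⋯`. -/
noncomputable def expo (lam : n.Partition) : ℕ →₀ ℕ := Multiset.toFinsupp (contentMultiset lam)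

/-- The number of ways to obtain the exponent of `λ` by merging parts of `κ`. -/
noncomputable def mergeCount (κ lam : n.Partition) : ℕ :=
  Nat.card {c : Fin κ.length → ℕ // ∑ i, Finsupp.single (c i) (κ.part i) = expo lam}

theorem coeff_p (κ lam : n.Partition) :
    MvPowerSeries.coeff (expo lam) (p F κ).1 = (mergeCount κ lam : F) := by
  have : (p F κ).1 = ∏ i, pSeries F (κ.part i) := by
    change (κ.parts.map (pSeries F)).prod = _
    rw [← κ.map_part, Multiset.map_map]
    rfl
  rw [this, coeff_prod_pSeries _ (part_pos κ)]
  rfl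

theorem finite_merge (κ lam : n.Partition) :
    Finite {c : Fin κ.length → ℕ // ∑ i, Finsupp.single (c i) (κ.part i) = expo lam} := by
  have hmem : ∀ c : {c : Fin κ.length → ℕ // ∑ i, Finsupp.single (c i) (κ.part i) = expo lam},
      ∀ i, c.1 i ∈ (expo lam).support := by
    intro c i
    have h3 := DFunLike.congr_fun c.2 (c.1 i)
    rw [Finsupp.finsetSum_apply] at h3
    rw [Finsupp.mem_support_iff]
    have h1 := Finset.single_le_sum (f := fun j => Finsupp.single (c.1 j) (κ.part j) (c.1 i))
      (fun _ _ => Nat.zero_le _) (Finset.mem_univ i)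
    have h2 := part_pos κ i
    simp only [Finsupp.single_eq_same] at h1
    omega
  refine Finite.of_injective (fun c i => (⟨c.1 i, hmem c i⟩ : (expo lam).support)) fun c d h => ?_
  exact Subtype.ext (funext fun i => congrArg Subtype.val (congrFun h i))

theorem mergeCount_self (lam : n.Partition) : mergeCount lam lam ≠ 0 := by
  have := finite_merge lam lam
  have : Nonempty {c : Fin lam.length → ℕ // ∑ i, Finsupp.single (c i) (lam.part i) = expo lam} := by
    -- No merging: the `i`-th part goes to its own variable, shifted by one as in `contentMultiset`.
    refine ⟨fun i => i.1 + 1, ?_⟩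
    rw [expo, contentMultiset, map_sum]
    refine Finset.sum_congr rfl fun i _ => ?_
    rw [← Multiset.nsmul_singleton, map_nsmul, Multiset.toFinsupp_singleton, Finsupp.smul_single,
      smul_eq_mul, mul_one]
  exact Nat.card_ne_zero.2 ⟨this, finite_merge lam lam⟩

/-- Merging parts never increases their number, and keeping the number forces the assignment `c` to
be injective, in which case the two partitions have the same parts. -/
theorem length_lt_of_mergeCount {κ lam : n.Partition} (h : mergeCount κ lam ≠ 0)
    (hne : κ ≠ lam) : lam.length < κ.length := by
  obtain ⟨⟨c, hc⟩⟩ := (Nat.card_ne_zero.1 h).1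
  have hsupp : (contentMultiset lam).toFinset ⊆ Finset.univ.image c := by
    intro x hx
    by_contra hx'
    have h1 : expo lam x = 0 := by
      rw [← hc, Finsupp.finsetSum_apply]
      refine Finset.sum_eq_zero fun i _ => Finsupp.single_eq_of_ne ?_
      rintro rfl
      exact hx' (Finset.mem_image_of_mem _ (Finset.mem_univ i))
    rw [expo, Multiset.toFinsupp_apply, Multiset.count_eq_zero] at h1
    exact h1 (Multiset.mem_toFinset.1 hx)
  have hcard : (contentMultiset lam).toFinset.card = lam.length := by
    rw [toFinset_contentMultiset, Finset.card_image_of_injective, Finset.card_univ,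
      Fintype.card_fin]
    intro i j h
    exact Fin.ext (by simpa using h)
  have h1 := Finset.card_le_card hsupp
  have h2 : (Finset.univ.image c).card ≤ κ.length := by
    simpa using Finset.card_image_le (s := Finset.univ) (f := c)
  refine lt_of_le_of_ne (hcard ▸ h1.trans h2) fun heq => hne ?_
  have hinj : Function.Injective c := by
    rw [← Set.injOn_univ, ← Finset.coe_univ]
    refine Finset.card_image_iff.1 ?_
    rw [Finset.card_univ, Fintype.card_fin]
    have h3 := Finset.card_le_card hsupp
    omega
  have himg : (contentMultiset lam).toFinset = Finset.univ.image c :=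
    Finset.eq_of_subset_of_card_le hsupp (by omega)
  apply Nat.Partition.ext
  rw [← map_count_contentMultiset lam, himg, Finset.image_val_of_injOn hinj.injOn,
    Multiset.map_map, ← κ.map_part]
  refine Multiset.map_congr rfl fun i _ => ?_
  have h3 := DFunLike.congr_fun hc (c i)
  rw [expo, Multiset.toFinsupp_apply, Finsupp.finsetSum_apply, Finset.sum_eq_single i] at h3
  · rw [Function.comp_apply, ← h3, Finsupp.single_eq_same]
  · intro j _ hj
    exact Finsupp.single_eq_of_ne fun h => hj (hinj h).symm
  · simp

variable {F} in
/-- The transition matrix from power sums to monomial symmetric functions is triangular. -/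
theorem eq_zero_of_sum_coeff_smul [CharZero F] {M : Type*} [AddCommGroup M] [Module F M]
    (x : n.Partition → M)
    (hx : ∀ lam : n.Partition, ∑ κ, MvPowerSeries.coeff (expo lam) (p F κ).1 • x κ = 0) : x = 0 := by
  classical
  by_contra h
  obtain ⟨κ₀, hκ₀⟩ := Function.ne_iff.1 h
  -- With `lam` of maximal length among the indices where `x` is nonzero, any other contributing `κ`
  -- would be strictly longer, so only the diagonal term survives.
  obtain ⟨lam, hlam, hmax⟩ := Finset.exists_max_image (Finset.univ.filter fun κ => x κ ≠ 0)
    (fun κ => κ.length) ⟨κ₀, by simpa using hκ₀⟩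
  have h1 := hx lam
  rw [Finset.sum_eq_single lam] at h1
  · rw [coeff_p, smul_eq_zero] at h1
    exact h1.elim (Nat.cast_ne_zero.2 (mergeCount_self lam)) (Finset.mem_filter.1 hlam).2
  · intro κ _ hκ
    by_contra h2
    obtain ⟨h3, h4⟩ := smul_ne_zero_iff.1 h2
    rw [coeff_p, Nat.cast_ne_zero] at h3
    have := length_lt_of_mergeCount h3 hκ
    have := hmax κ (by simpa using h4)
    omega
  · simp

theorem linearIndependent_p [CharZero F] : LinearIndependent F (p F : n.Partition → SymFun F n) := by
  rw [Fintype.linearIndependent_iff]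
  intro g hg i
  refine congrFun (eq_zero_of_sum_coeff_smul (F := F) g fun lam => ?_) i
  have h1 := congrArg (fun f : SymFun F n => MvPowerSeries.coeff (expo lam) f.1) hg
  simp only [AddSubmonoidClass.coe_finsetSum, map_sum, Submodule.coe_smul, map_smul, smul_eq_mul,
    ZeroMemClass.coe_zero, map_zero] at h1
  simpa only [smul_eq_mul, mul_comm] using h1

/-- Exponents of degree `n` are permutations of exponents of partitions. -/
theorem exists_mapDomain_eq_expo (m : ℕ →₀ ℕ) (hm : m.degree = n) :
    ∃ (lam : n.Partition) (w : Equiv.Perm ℕ), (expo lam).mapDomain w = m := by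
  let lam : n.Partition := multisetType (Finsupp.toMultiset m) (by
    rw [Finsupp.card_toMultiset, ← hm]; rfl)
  have hparts : lam.parts = (Finsupp.toMultiset m).toFinset.val.map (Finsupp.toMultiset m).count := rfl
  have h1 := lam.map_part
  rw [hparts] at h1
  obtain ⟨f, hf⟩ := exists_map_univ_eq (X := Fin lam.length) (Finsupp.toMultiset m).toFinset.val (by
    have := congrArg Multiset.card h1
    simpa using this.symm)
  have hfinj : Function.Injective f := by
    have hnd : (Finset.univ.val.map f).Nodup := hf ▸ (Finsupp.toMultiset m).toFinset.nodup
    exact fun i j h => Multiset.inj_on_of_nodup_map hnd i (Finset.mem_univ_val i) j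
      (Finset.mem_univ_val j) h
  have h2 : (Finset.univ.val.map lam.part) = Finset.univ.val.map fun i => m (f i) := by
    rw [h1, ← hf, Multiset.map_map]
    exact Multiset.map_congr rfl fun i _ => by rw [Function.comp_apply, Finsupp.count_toMultiset]
  obtain ⟨e, he⟩ := exists_perm_of_map_univ_eq h2
  -- An injection between finite sets of variables extends to a permutation of all variables.
  have hpre := Equiv.Perm.isMultiplyPretransitive ℕ lam.length
  obtain ⟨w, hw⟩ := (MulAction.isMultiplyPretransitive_iff (G := Equiv.Perm ℕ) (α := ℕ)
    (n := lam.length)).1 hpre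
    (x := ⟨fun i => i.1 + 1, fun i j h => Fin.ext (by simpa using h)⟩)
    (y := ⟨fun i => f (e i), hfinj.comp e.injective⟩)
  refine ⟨lam, w, ?_⟩
  have hw' : ∀ i : Fin lam.length, w (i.1 + 1) = f (e i) := fun i => DFunLike.congr_fun hw i
  have h3 : expo lam = ∑ i : Fin lam.length, Finsupp.single (i.1 + 1) (lam.part i) := by
    rw [expo, contentMultiset, map_sum]
    refine Finset.sum_congr rfl fun i _ => ?_
    rw [← Multiset.nsmul_singleton, map_nsmul, Multiset.toFinsupp_singleton, Finsupp.smul_single,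
      smul_eq_mul, mul_one]
  rw [h3, Finsupp.mapDomain_finsetSum]
  simp_rw [Finsupp.mapDomain_single, hw', ← he]
  rw [Equiv.sum_comp e fun i => Finsupp.single (f i) (m (f i))]
  have h4 : ∑ i, Finsupp.single (f i) (m (f i)) =
      ((Finset.univ.val.map f).map fun x => Finsupp.single x (m x)).sum := by
    rw [Multiset.map_map]
    rfl
  rw [h4, hf]
  have h5 : (Finsupp.toMultiset m).toFinset = m.support := Finsupp.toFinset_toMultiset m
  rw [h5]
  exact m.sum_single

/-- By symmetry an element of `Λ_n` is determined by its coefficients at the exponents `expo lam`.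
Hence the dimension is at most the number of partitions, and the independent family of power sums,
having that size, spans. -/
theorem span_p [CharZero F] : Submodule.span F (Set.range (p F : n.Partition → SymFun F n)) = ⊤ := by
  let φ : SymFun F n →ₗ[F] n.Partition → F :=
    LinearMap.pi fun lam => (MvPowerSeries.coeff (expo lam)).comp (SymFun F n).subtype
  have hφ : Function.Injective φ := by
    rw [injective_iff_map_eq_zero]
    intro f hf
    ext m
    change MvPowerSeries.coeff m f.1 = 0
    by_contra hm
    obtain ⟨lam, w, rfl⟩ := exists_mapDomain_eq_expo m (f.2.1 m hm)
    rw [f.2.2] at hm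
    exact hm (congrFun hf lam)
  have : FiniteDimensional F (SymFun F n) := FiniteDimensional.of_injective φ hφ
  refine (linearIndependent_p F).span_eq_top_of_card_eq_finrank' ?_
  refine le_antisymm (linearIndependent_p F).fintype_card_le_finrank ?_
  simpa using LinearMap.finrank_le_finrank_of_injective hφ

/-- The basis of power sums. -/
noncomputable def pBasis [CharZero F] : Module.Basis n.Partition F (SymFun F n) :=
  Module.Basis.mk (linearIndependent_p F) (span_p F).ge

theorem pBasis_apply [CharZero F] (κ : n.Partition) : pBasis F κ = p F κ := Module.Basis.mk_apply _ _ _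

theorem exists_cyc_eq (κ : n.Partition) :
    ∃ w : Equiv.Perm (Fin n), cyc (Fintype.card_fin n) w = κ := by
  have hsplit := Multiset.filter_add_not (fun k => 2 ≤ k) κ.parts
  have hone : κ.parts.filter (fun k => ¬ 2 ≤ k) =
      Multiset.replicate (Multiset.card (κ.parts.filter fun k => ¬ 2 ≤ k)) 1 := by
    refine Multiset.eq_replicate_card.2 fun k hk => ?_
    have h1 := κ.parts_pos (Multiset.mem_of_mem_filter hk)
    have h2 := Multiset.of_mem_filter hk
    omega
  have hsum := congrArg Multiset.sum hsplit
  rw [κ.parts_sum, Multiset.sum_add, hone, Multiset.sum_replicate, smul_eq_mul, mul_one] at hsum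
  obtain ⟨w, hw⟩ := (Equiv.Perm.exists_with_cycleType_iff (Fin n)
    (m := κ.parts.filter fun k => 2 ≤ k)).2 ⟨by rw [Fintype.card_fin]; omega,
      fun k hk => Multiset.of_mem_filter hk⟩
  refine ⟨w, Nat.Partition.ext ?_⟩
  change w.partition.parts = _
  rw [Equiv.Perm.parts_partition, hw, ← w.sum_cycleType, hw, Fintype.card_fin]
  conv_rhs => rw [← hsplit, hone]
  congr 2
  omega

variable {F} in
/-- A linear map on `Λ_n` is determined by its values on the complete homogeneous functions. -/
theorem linearMap_eq_of_h [CharZero F] {M : Type*} [AddCommGroup M] [Module F M]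
    {ψ ψ' : SymFun F n →ₗ[F] M} (h : ∀ lam, ψ (SymFun.h F lam) = ψ' (SymFun.h F lam)) : ψ = ψ' := by
  classical
  set φ := ψ - ψ' with hφ
  have h0 : ∀ lam, φ (SymFun.h F lam) = 0 := fun lam => by simp [hφ, h]
  let N : n.Partition → F := fun κ =>
    ((Finset.univ.filter fun w : Equiv.Perm (Fin n) => cyc (Fintype.card_fin n) w = κ).card : F)
  -- Grouping `n! h_λ = ∑_w (fixed words) p_{cyc(w)}` by cycle type gives `∑_κ N κ [x^λ](p_κ) p_κ`,
  -- so the same triangular system governs the vectors `N κ • φ (p_κ)`.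
  have h1 : (fun κ => N κ • φ (p F κ)) = 0 := by
    refine eq_zero_of_sum_coeff_smul (F := F) _ fun lam => ?_
    have h2 := h0 lam
    rw [← multisetType_contentMultiset lam, SymFun.h_multisetType F (Fintype.card_fin n), map_smul,
      smul_eq_zero_iff_right (inv_ne_zero (Nat.cast_ne_zero.2 n.factorial_ne_zero)), map_sum,
      ← Finset.sum_fiberwise Finset.univ (cyc (Fintype.card_fin n))] at h2
    rw [← h2]
    refine Finset.sum_congr rfl fun κ _ => ?_
    have h3 : ∀ w ∈ Finset.univ.filter fun w : Equiv.Perm (Fin n) =>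
        cyc (Fintype.card_fin n) w = κ, φ ((Word.fixedCount (contentMultiset lam) w : F) •
          p F (cyc (Fintype.card_fin n) w)) =
        MvPowerSeries.coeff (expo lam) (p F κ).1 • φ (p F κ) := by
      intro w hw
      have h4 := coeff_p_cyc F (Fintype.card_fin n) w (expo lam)
      rw [expo, Multiset.toFinsupp_toMultiset] at h4
      rw [map_smul, ← h4, (Finset.mem_filter.1 hw).2]
      rfl
    rw [Finset.sum_congr rfl h3, Finset.sum_const, smul_comm, ← Nat.cast_smul_eq_nsmul F]
  have h2 : φ = 0 := by
    refine (pBasis F).ext fun κ => ?_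
    rw [pBasis_apply, LinearMap.zero_apply]
    obtain ⟨w, hw⟩ := exists_cyc_eq κ
    refine (smul_eq_zero_iff_right (Nat.cast_ne_zero.2 ?_)).1 (congrFun h1 κ)
    exact Finset.card_ne_zero.2 ⟨w, by simpa using hw⟩
  exact sub_eq_zero.1 h2

end SymFun

/-! ### The character of `η_μ V` and the existence of `ψ_μ` -/

namespace Nat.Partition

variable {n : ℕ} (μ : n.Partition) {F V : Type*} [Field F] [AddCommGroup V] [Module F V]

open Classical in
theorem asAlgebraHom_eta_apply (ρ : Representation F (Equiv.Perm (Fin n)) V) (v : V) :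
    ρ.asAlgebraHom (μ.eta F) v = ∑ w : μ.young, ρ w.1 v := by
  simp [eta, map_sum, Representation.asAlgebraHom_single]

/-- This is `η_μ² = |𝔖_μ| η_μ`: every `w ∈ 𝔖_μ` is absorbed by `η_μ`. -/
theorem asAlgebraHom_eta_of_mem (ρ : Representation F (Equiv.Perm (Fin n)) V) {v : V}
    (hv : v ∈ μ.etaSubmodule ρ) :
    ρ.asAlgebraHom (μ.eta F) v = (Nat.card μ.young : F) • v := by
  classical
  obtain ⟨v, rfl⟩ := hv
  have h1 : ∀ w : μ.young, ρ w.1 (ρ.asAlgebraHom (μ.eta F) v) = ρ.asAlgebraHom (μ.eta F) v := by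
    intro w
    rw [asAlgebraHom_eta_apply, map_sum]
    conv_rhs => rw [← Equiv.sum_comp (Equiv.mulLeft w)]
    refine Finset.sum_congr rfl fun x _ => ?_
    rw [Equiv.coe_mulLeft, Subgroup.coe_mul, map_mul, Module.End.mul_apply]
  rw [asAlgebraHom_eta_apply, Finset.sum_congr rfl fun w _ => h1 w, Finset.sum_const,
    Finset.card_univ, Nat.card_eq_fintype_card, Nat.cast_smul_eq_nsmul]

-- Factor `η_μ` as the surjection `E` onto its range followed by the inclusion. In the other order
-- the composite is the scalar `|𝔖_μ|`, so cyclicity of the trace moves the trace from `η_μ V` to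
-- `V`.
open Classical in
theorem character_etaRep [CharZero F] [FiniteDimensional F V]
    (ρ : Representation F (Equiv.Perm (Fin n)) V) (u : μ.stab) :
    (μ.etaRep ρ).character u =
      (Nat.card μ.young : F)⁻¹ * ∑ w : μ.young, ρ.character (w.1 * μ.iota u) := by
  have hY : (Nat.card μ.young : F) ≠ 0 := Nat.cast_ne_zero.2 Nat.card_pos.ne'
  rw [eq_inv_mul_iff_mul_eq₀ hY]
  let E : V →ₗ[F] μ.etaSubmodule ρ := (ρ.asAlgebraHom (μ.eta F)).rangeRestrict
  have h1 : (E ∘ₗ (μ.etaSubmodule ρ).subtype) = (Nat.card μ.young : F) • LinearMap.id := by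
    ext v
    exact μ.asAlgebraHom_eta_of_mem ρ v.2
  have h2 : (Nat.card μ.young : F) • μ.etaRep ρ u =
      (μ.etaRep ρ u ∘ₗ E) ∘ₗ (μ.etaSubmodule ρ).subtype := by
    rw [LinearMap.comp_assoc, h1, LinearMap.comp_smul, LinearMap.comp_id]
  have h3 : (μ.etaSubmodule ρ).subtype ∘ₗ (μ.etaRep ρ u ∘ₗ E) =
      ∑ w : μ.young, ρ (μ.iota u * w.1) := by
    ext v
    have : ((μ.etaSubmodule ρ).subtype ∘ₗ (μ.etaRep ρ u ∘ₗ E)) v =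
      ρ (μ.iota u) (ρ.asAlgebraHom (μ.eta F) v) := rfl
    rw [this, asAlgebraHom_eta_apply, map_sum, LinearMap.sum_apply]
    simp_rw [map_mul, Module.End.mul_apply]
  rw [Representation.character, ← smul_eq_mul, ← map_smul, h2, LinearMap.trace_comp_comm', h3,
    map_sum]
  exact Finset.sum_congr rfl fun w _ => ρ.char_mul_comm _ _

/-- The factors of `𝔖_{m_0} × ⋯ × 𝔖_{m_{r-1}}` contribute the tensor `p_{cyc(u_0)} ⊗ ⋯`. -/
noncomputable def cycTensor (F : Type*) [Field F] {r : ℕ} (a : Fin r → ℕ) (u : μ.stab) :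
    ⨂[F] i, SymFun F (μ.parts.count (a i)) :=
  open Classical in
  PiTensorProduct.tprod F fun i => SymFun.p F (cyc (μ.card_block (a i)) (μ.stabRestrict u (a i)))

open Classical in
/-- The Frobenius image of `η_μ V` as a function of the character of `V`. -/
noncomputable def etaFrob (F : Type*) [Field F] {r : ℕ} (a : Fin r → ℕ) :
    (Equiv.Perm (Fin n) → F) →ₗ[F] ⨂[F] i, SymFun F (μ.parts.count (a i)) :=
  (Nat.card μ.stab : F)⁻¹ • ∑ u : μ.stab, ((Nat.card μ.young : F)⁻¹ • ∑ w : μ.young,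
    (LinearMap.proj (w.1 * μ.iota u) : (Equiv.Perm (Fin n) → F) →ₗ[F] F)).smulRight
      (μ.cycTensor F a u)

open Classical in
theorem etaFrob_apply {r : ℕ} (a : Fin r → ℕ) (χ : Equiv.Perm (Fin n) → F) :
    μ.etaFrob F a χ = (Nat.card μ.stab : F)⁻¹ • ∑ u : μ.stab,
      ((Nat.card μ.young : F)⁻¹ * ∑ w : μ.young, χ (w.1 * μ.iota u)) • μ.cycTensor F a u := by
  simp [etaFrob, LinearMap.sum_apply]

theorem frobStab_etaRep [CharZero F] [FiniteDimensional F V] {r : ℕ} (a : Fin r → ℕ)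
    (ρ : Representation F (Equiv.Perm (Fin n)) V) :
    μ.frobStab a (μ.etaRep ρ) = μ.etaFrob F a ρ.character := by
  classical
  rw [etaFrob_apply, frobStab]
  simp_rw [character_etaRep]
  rfl

end Nat.Partition

/-! ### Recovering a character from its Frobenius image -/

namespace SymFun

variable {F : Type*} [Field F] [CharZero F] {n : ℕ}

open Classical in
/-- The class function whose Frobenius image is a given symmetric function. -/
noncomputable def classFun (F : Type*) [Field F] [CharZero F] (n : ℕ) :
    SymFun F n →ₗ[F] (Equiv.Perm (Fin n) → F) :=
  (pBasis F).constr F fun κ w => if cyc (Fintype.card_fin n) w = κ then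
    ((n.factorial : ℕ) : F) * ((Finset.univ.filter fun v : Equiv.Perm (Fin n) =>
      cyc (Fintype.card_fin n) v = κ).card : F)⁻¹ else 0

/-- A character is constant on each cycle type. The `N` permutations with the cycle type of `w` each
contribute `χ(w) n! / N`, and the factor `1 / n!` in `frob` cancels the rest. -/
theorem classFun_frob {V : Type*} [AddCommGroup V] [Module F V]
    (ρ : Representation F (Equiv.Perm (Fin n)) V) : classFun F n (frob ρ) = ρ.character := by
  classical
  ext w
  set N := (Finset.univ.filter fun v : Equiv.Perm (Fin n) =>
    cyc (Fintype.card_fin n) v = cyc (Fintype.card_fin n) w).card with hN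
  have hN0 : (N : F) ≠ 0 := Nat.cast_ne_zero.2 (Finset.card_ne_zero.2 ⟨w, by simp⟩)
  have hn : ((n.factorial : ℕ) : F) ≠ 0 := Nat.cast_ne_zero.2 n.factorial_ne_zero
  have h1 : ∀ v, ρ.character v * classFun F n (p F (cyc (Fintype.card_fin n) v)) w =
      if cyc (Fintype.card_fin n) v = cyc (Fintype.card_fin n) w then
        ρ.character w * (((n.factorial : ℕ) : F) * (N : F)⁻¹) else 0 := by
    intro v
    rw [← pBasis_apply, classFun, Module.Basis.constr_basis]
    by_cases h : cyc (Fintype.card_fin n) v = cyc (Fintype.card_fin n) w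
    · have hparts : (cyc (Fintype.card_fin n) v).parts = (cyc (Fintype.card_fin n) w).parts := by
        rw [h]
      have hpart : v.partition = w.partition := Nat.Partition.ext hparts
      obtain ⟨g, hg⟩ := isConj_iff.1 (Equiv.Perm.partition_eq_of_isConj.2 hpart)
      rw [if_pos h, if_pos h.symm, ← hg, ρ.char_conj, hN]
      simp only [h]
    · rw [if_neg h, if_neg fun h' => h h'.symm, mul_zero]
  rw [frob, map_smul, map_sum, Pi.smul_apply, Finset.sum_apply]
  simp_rw [map_smul, Pi.smul_apply, smul_eq_mul]
  rw [Finset.sum_congr rfl fun v _ => h1 v, ← Finset.sum_filter, Finset.sum_const, ← hN,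
    nsmul_eq_mul]
  field_simp

end SymFun

theorem existsUnique_isPsi {F : Type u} [Field F] [CharZero F] {n : ℕ} (μ : n.Partition) {r : ℕ}
    (a : Fin r → ℕ) :
    ∃! ψ : SymFun F n →ₗ[F] ⨂[F] i, SymFun F (μ.parts.count (a i)), IsPsi μ a ψ := by
  refine ⟨μ.etaFrob F a ∘ₗ SymFun.classFun F n, ?_, ?_⟩
  · intro V _ _ _ ρ
    rw [LinearMap.comp_apply, SymFun.classFun_frob, μ.frobStab_etaRep]
  · intro ψ hψ
    refine SymFun.linearMap_eq_of_h (F := F)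
      (M := ⨂[F] i, SymFun F (μ.parts.count (a i))) fun lam => ?_
    rw [LinearMap.comp_apply, ← frob_wordRep, SymFun.classFun_frob, hψ, μ.frobStab_etaRep]

/-! ### Fixed points of the block permutations on the tuples of block contents -/

theorem map_univ_eq_sum {X Y : Type*} [Fintype X] (f : X → Y) :
    Finset.univ.val.map f = ∑ x, ({f x} : Multiset Y) := by
  rw [← Multiset.sum_map_singleton (Finset.univ.val.map f), Multiset.map_map]
  rfl

namespace Nat.Partition

variable {n : ℕ} (μ : n.Partition) {α : Type*}

/-- The multisets of letters of a word in the consecutive intervals. -/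
def blockContent (f : Fin n → α) (i : Fin μ.length) : Multiset α :=
  Finset.univ.val.map fun j => f (μ.blockEquiv ⟨i, j⟩)

theorem block_blockEquiv (i : Fin μ.length) (j : Fin (μ.part i)) :
    μ.block (μ.blockEquiv ⟨i, j⟩) = i := by
  simp [block]

theorem card_blockContent (f : Fin n → α) (i : Fin μ.length) :
    Multiset.card (μ.blockContent f i) = μ.part i := by
  simp [blockContent]

theorem sum_blockContent (f : Fin n → α) :
    ∑ i, μ.blockContent f i = Finset.univ.val.map f := by
  simp_rw [blockContent, map_univ_eq_sum]
  rw [← Equiv.sum_comp μ.blockEquiv, Fintype.sum_sigma]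

theorem map_block_pair (f : Fin n → α) :
    (Finset.univ.val.map fun x => (μ.block x, f x)) =
      ∑ i, (μ.blockContent f i).map (Prod.mk i) := by
  rw [← μ.sum_blockContent]
  refine Finset.sum_congr rfl fun i _ => ?_
  simp_rw [blockContent, Multiset.map_map, Function.comp_def, block_blockEquiv]

theorem blockContent_eq_of_map_block_pair {f g : Fin n → α}
    (h : (Finset.univ.val.map fun x => (μ.block x, f x)) =
      Finset.univ.val.map fun x => (μ.block x, g x)) : μ.blockContent f = μ.blockContent g := by
  classical
  have hcount : ∀ (f : Fin n → α) i b, (Finset.univ.val.map fun x => (μ.block x, f x)).count (i, b) =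
      (μ.blockContent f i).count b := by
    intro f i b
    rw [map_block_pair, Multiset.count_sum', Finset.sum_eq_single i]
    · rw [Multiset.count_map_eq_count' _ _ (Prod.mk_right_injective _)]
    · intro j _ hj
      refine Multiset.count_eq_zero_of_notMem fun h => hj ?_
      obtain ⟨_, -, h⟩ := Multiset.mem_map.1 h
      exact congrArg Prod.fst h
    · simp
  funext i
  ext b
  rw [← hcount, ← hcount, h]

/-- Attach to each letter the index of its interval. Equal block contents mean equal multisets of
labelled letters, and a permutation matching labelled letters preserves the intervals, so it lies in
`𝔖_μ`. -/
theorem blockContent_eq_iff {S : Multiset α} (f g : Word (Fin n) S) :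
    μ.blockContent f.1 = μ.blockContent g.1 ↔ ∃ w : μ.young, w • f = g := by
  constructor
  · intro h
    have h1 := μ.map_block_pair f.1
    rw [h, ← map_block_pair] at h1
    obtain ⟨w, hw⟩ := exists_perm_of_map_univ_eq h1
    exact ⟨⟨w, fun x => congrArg Prod.fst (hw x)⟩,
      (Word.smul_eq_iff _ _ _).2 fun x => congrArg Prod.snd (hw x)⟩
  · rintro ⟨w, hw⟩
    refine μ.blockContent_eq_of_map_block_pair ?_
    have hw' := (Word.smul_eq_iff w.1 f g).1 hw
    rw [← map_univ_comp_perm (fun x => (μ.block x, g.1 x)) w.1]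
    simp_rw [hw', w.2 _]

theorem blockContent_iota_smul {S : Multiset α} (u : μ.stab) (f : Word (Fin n) S) :
    μ.blockContent (μ.iota u • f).1 = fun i => μ.blockContent f.1 (u.1⁻¹ i) := by
  funext i
  have h1 : ∀ j, (μ.iota u • f).1 (μ.blockEquiv ⟨i, j⟩) =
      f.1 (μ.blockEquiv ⟨u.1⁻¹ i, finCongr (u⁻¹.2 i).symm j⟩) := by
    intro j
    rw [Word.smul_val, ← map_inv]
    simp only [iota, MonoidHom.coe_mk, OneHom.coe_mk, Equiv.permCongr_apply,
      Equiv.symm_apply_apply]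
    rfl
  simp_rw [blockContent, h1]
  conv_rhs => rw [← Multiset.map_univ_val_equiv (finCongr (u⁻¹.2 i).symm), Multiset.map_map]
  rfl

theorem exists_blockContent_eq (D : Fin μ.length → Multiset α)
    (hD : ∀ i, Multiset.card (D i) = μ.part i) : ∃ f : Fin n → α, μ.blockContent f = D := by
  choose f hf using fun i => exists_map_univ_eq (X := Fin (μ.part i)) (D i) (by simpa using hD i)
  let g : (Σ i : Fin μ.length, Fin (μ.part i)) → α := fun q => f q.1 q.2
  refine ⟨fun x => g (μ.blockEquiv.symm x), funext fun i => ?_⟩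
  rw [← hf, blockContent]
  exact Multiset.map_congr rfl fun j _ => congrArg g (μ.blockEquiv.symm_apply_apply ⟨i, j⟩)

/-- The tuples `(B_1, …, B_k)` of multisets with union `S` and sizes `μ_1, …, μ_k` that are fixed
by an element of `Stab(μ)`. -/
def FixedTuple (S : Multiset α) (u : μ.stab) : Type _ :=
  {D : Fin μ.length → Multiset α // ((∀ i, Multiset.card (D i) = μ.part i) ∧ ∑ i, D i = S) ∧
    ∀ i, D (u.1 i) = D i}

-- The twisted orbit count for `𝔖_μ` acting on words, with twist `ι_μ(u)`: orbits are tuples of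
-- block contents, on which the twist acts by permuting indices.
open Classical in
theorem sum_fixedCount_young_mul_iota (S : Multiset α) (u : μ.stab) :
    ∑ w : μ.young, Word.fixedCount S (w.1 * μ.iota u) =
      Nat.card μ.young * Nat.card (μ.FixedTuple S u) := by
  have key := sum_card_smul_eq_self (G := μ.young) (T := Word (Fin n) S)
    (fun f => μ.blockContent f.1) μ.blockContent_eq_iff (fun f => μ.iota u • f)
    (fun D i => D (u.1⁻¹ i)) (μ.blockContent_iota_smul u)
  refine (Finset.sum_congr rfl fun w _ => ?_).trans (key.trans (congrArg _ ?_))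
  · rw [Word.fixedCount]
    simp_rw [mul_smul]
    rfl
  · refine Nat.card_congr (Equiv.subtypeEquivRight fun D => and_congr ?_ ?_)
    · constructor
      · rintro ⟨f, rfl⟩
        exact ⟨μ.card_blockContent f.1, (μ.sum_blockContent f.1).trans f.2⟩
      · rintro ⟨h1, h2⟩
        obtain ⟨f, rfl⟩ := μ.exists_blockContent_eq D h1
        exact ⟨⟨f, (μ.sum_blockContent f).symm.trans h2⟩, rfl⟩
    · constructor
      · intro h i
        have := congrFun h (u.1 i)
        simpa using this.symm
      · intro h
        funext i
        have := h (u.1⁻¹ i)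
        simpa using this.symm

/-! ### Decomposition along the distinct part sizes -/

/-- The indices of the parts, sorted by the sizes of the parts. -/
noncomputable def sizeEquiv {r : ℕ} {a : Fin r → ℕ} (ha : Function.Injective a)
    (hparts : ∀ x : ℕ, x ∈ μ.parts ↔ ∃ i, a i = x) :
    (Σ i, {j // μ.part j = a i}) ≃ Fin μ.length :=
  Equiv.ofBijective (fun q => q.2.1) <| by
    constructor
    · rintro ⟨i, j, hj⟩ ⟨i', j', hj'⟩ h
      simp only at h
      subst h
      obtain rfl := ha (hj.symm.trans hj')
      rfl
    · intro j
      obtain ⟨i, hi⟩ := (hparts (μ.part j)).1 (by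
        rw [← μ.map_part]; exact Multiset.mem_map_of_mem _ (Finset.mem_univ_val j))
      exact ⟨⟨i, j, hi.symm⟩, rfl⟩

section Sizes

variable {r : ℕ} {a : Fin r → ℕ}

theorem sizeEquiv_symm_apply (ha : Function.Injective a)
    (hparts : ∀ x : ℕ, x ∈ μ.parts ↔ ∃ i, a i = x)
    (i : Fin r) (j : {j // μ.part j = a i}) :
    (μ.sizeEquiv ha hparts).symm j.1 = ⟨i, j⟩ :=
  (μ.sizeEquiv ha hparts).symm_apply_apply ⟨i, j⟩

/-- `Stab(μ)` is the product of the symmetric groups on the sets of parts of equal size. -/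
noncomputable def stabEquiv (ha : Function.Injective a)
    (hparts : ∀ x : ℕ, x ∈ μ.parts ↔ ∃ i, a i = x)
    : μ.stab ≃ ∀ i, Equiv.Perm {j // μ.part j = a i} :=
  Equiv.ofBijective (fun u i => μ.stabRestrict u (a i)) <| by
    constructor
    · intro u v h
      refine Subtype.ext (Equiv.ext fun j => ?_)
      obtain ⟨q, rfl⟩ := (μ.sizeEquiv ha hparts).surjective j
      exact congrArg Subtype.val (Equiv.congr_fun (congrFun h q.1) q.2)
    · intro v
      refine ⟨⟨(μ.sizeEquiv ha hparts).permCongr (Equiv.sigmaCongrRight v), fun j => ?_⟩,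
        funext fun i => Equiv.ext fun j => Subtype.ext ?_⟩
      · obtain ⟨⟨i, j⟩, rfl⟩ := (μ.sizeEquiv ha hparts).surjective j
        rw [Equiv.permCongr_apply, Equiv.symm_apply_apply]
        exact (v i j).2.trans j.2.symm
      · change (μ.sizeEquiv ha hparts).permCongr (Equiv.sigmaCongrRight v) j.1 = _
        rw [Equiv.permCongr_apply, sizeEquiv_symm_apply]
        rfl

open Classical in
theorem card_stab (ha : Function.Injective a)
    (hparts : ∀ x : ℕ, x ∈ μ.parts ↔ ∃ i, a i = x)
    : Nat.card μ.stab = ∏ i, (μ.parts.count (a i)).factorial := by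
  rw [Nat.card_congr (μ.stabEquiv ha hparts), Nat.card_pi]
  refine Finset.prod_congr rfl fun i _ => ?_
  rw [Nat.card_perm, Nat.card_eq_fintype_card, card_block]

theorem map_subtype_eq_filter {X Y : Type*} [Fintype X] (f : X → Y) (p : X → Prop)
    [DecidablePred p] [DecidableEq Y] :
    (Finset.univ.val.map fun x : {x // p x} => f x.1) = (Finset.univ.filter p).val.map f := by
  rw [map_univ_eq_sum, ← Finset.sum_subtype (Finset.univ.filter p) (by simp)
    (fun x => ({f x} : Multiset Y)), ← Multiset.sum_map_singleton ((Finset.univ.filter p).val.map f),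
    Multiset.map_map]
  rfl

theorem sum_restrict (ha : Function.Injective a)
    (hparts : ∀ x : ℕ, x ∈ μ.parts ↔ ∃ i, a i = x)
    {S : Multiset ℕ} (π : MultisetPartition S μ) :
    ∑ i, π.restrict (a i) = π.1 := by
  classical
  ext B
  rw [Multiset.count_sum']
  simp_rw [MultisetPartition.restrict, Multiset.count_filter]
  by_cases hB : B ∈ π.1
  · obtain ⟨i, hi⟩ := (hparts (Multiset.card B)).1 (by
      rw [← π.2.2]; exact Multiset.mem_map_of_mem _ hB)
    rw [Finset.sum_eq_single i, if_pos hi.symm]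
    · intro j _ hj
      exact if_neg fun h => hj (ha (h.symm.trans hi.symm))
    · simp
  · rw [Multiset.count_eq_zero_of_notMem hB]
    simp

-- A fixed tuple has an underlying multiset partition `π`. Restricted to the indices of parts of
-- size `a_i` it is a word of content `π|_{a_i}`, since block sizes are prescribed. Being fixed by
-- `u` is a condition on each restriction separately.
open Classical in
theorem card_fixedTuple (ha : Function.Injective a)
    (hparts : ∀ x : ℕ, x ∈ μ.parts ↔ ∃ i, a i = x)
    (S : Multiset ℕ) (u : μ.stab) :
    Nat.card (μ.FixedTuple S u) = ∑ π : MultisetPartition S μ,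
      ∏ i, Word.fixedCount (π.restrict (a i)) (μ.stabRestrict u (a i)) := by
  simp_rw [Word.fixedCount, ← Nat.card_pi]
  rw [← Nat.card_sigma]
  symm
  let e := μ.sizeEquiv ha hparts
  let glue (π : MultisetPartition S μ)
      (B : ∀ i, {f : Word {j // μ.part j = a i} (π.restrict (a i)) //
        μ.stabRestrict u (a i) • f = f}) (j : Fin μ.length) : Multiset ℕ :=
    (B (e.symm j).1).1.1 (e.symm j).2
  have hglue : ∀ π B i (j : {j // μ.part j = a i}), glue π B j.1 = (B i).1.1 j := by
    intro π B i j
    have : e.symm j.1 = ⟨i, j⟩ := μ.sizeEquiv_symm_apply ha hparts i j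
    simp only [glue]
    rw [this]
  have hmap : ∀ π B, Finset.univ.val.map (glue π B) = π.1 := by
    intro π B
    rw [← μ.sum_restrict ha hparts π, map_univ_eq_sum, ← Equiv.sum_comp e, Fintype.sum_sigma]
    refine Finset.sum_congr rfl fun i _ => ?_
    rw [← (B i).1.2, map_univ_eq_sum]
    exact Finset.sum_congr rfl fun j _ => by rw [← hglue π B i j]; rfl
  refine Nat.card_congr (Equiv.ofBijective
    (fun q => ⟨glue q.1 q.2, ⟨fun j => ?_, ?_⟩, fun j => ?_⟩) ⟨?_, ?_⟩)
  · obtain ⟨⟨i, j⟩, rfl⟩ := e.surjective j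
    have h1 := (q.2 i).1.mem j
    have h2 : Multiset.card ((q.2 i).1.1 j) = a i :=
      (Multiset.mem_filter.1 h1).2
    exact (congrArg Multiset.card (hglue q.1 q.2 i j)).trans (h2.trans j.2.symm)
  · have h1 := congrArg Multiset.sum (hmap q.1 q.2)
    exact h1.trans q.1.2.1
  · obtain ⟨⟨i, j⟩, rfl⟩ := e.surjective j
    have h1 := (Word.smul_eq_iff _ _ _).1 (q.2 i).2 j
    rw [← hglue, ← hglue] at h1
    exact h1
  · rintro ⟨π, B⟩ ⟨π', B'⟩ h
    have h1 : glue π B = glue π' B' := congrArg Subtype.val h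
    obtain rfl : π = π' := Subtype.ext (by rw [← hmap π B, h1, hmap])
    congr 1
    funext i
    refine Subtype.ext (Subtype.ext (funext fun j => ?_))
    rw [← hglue, ← hglue, h1]
  · rintro ⟨D, ⟨hD, hS⟩, hu⟩
    let π : MultisetPartition S μ := ⟨Finset.univ.val.map D, hS, by
      rw [Multiset.map_map, ← μ.map_part]
      exact Multiset.map_congr rfl fun i _ => hD i⟩
    have hrestr : ∀ i, (Finset.univ.val.map fun j : {j // μ.part j = a i} => D j.1) =
        π.restrict (a i) := by
      intro i
      rw [map_subtype_eq_filter, MultisetPartition.restrict, Finset.filter_val,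
        Multiset.filter_map]
      simp only [Function.comp_def, hD]
    let B : ∀ i, {f : Word {j // μ.part j = a i} (π.restrict (a i)) //
        μ.stabRestrict u (a i) • f = f} := fun i => ⟨⟨fun j => D j.1, hrestr i⟩,
      (Word.smul_eq_iff _ _ _).2 fun j => hu j.1⟩
    refine ⟨⟨π, B⟩, Subtype.ext (funext fun j => ?_)⟩
    obtain ⟨⟨i, j⟩, rfl⟩ := e.surjective j
    exact hglue π B i j

open Classical in
/-- The Frobenius image of the permutation character of a product of symmetric groups is the
tensor product of complete homogeneous symmetric functions. -/
theorem sum_prod_fixedCount_smul_cycTensor (ha : Function.Injective a)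
    (hparts : ∀ x : ℕ, x ∈ μ.parts ↔ ∃ i, a i = x)
    {F : Type*} [Field F] [CharZero F] {S : Multiset ℕ}
    (π : MultisetPartition S μ) :
    (Nat.card μ.stab : F)⁻¹ • ∑ u : μ.stab,
      ((∏ i, Word.fixedCount (π.restrict (a i)) (μ.stabRestrict u (a i)) : ℕ) : F) •
        μ.cycTensor F a u =
      PiTensorProduct.tprod F fun i =>
        SymFun.h F (multisetType (π.restrict (a i)) (π.card_restrict (a i))) := by
  simp_rw [fun i => SymFun.h_multisetType F (μ.card_block (a i)) (π.card_restrict (a i))]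
  -- Multilinearity turns the tensor of sums into one sum over families of permutations, which
  -- `stabEquiv` identifies with `Stab(μ)`.
  rw [MultilinearMap.map_smul_univ, MultilinearMap.map_sum]
  simp_rw [MultilinearMap.map_smul_univ]
  rw [← Equiv.sum_comp (μ.stabEquiv ha hparts), μ.card_stab ha hparts]
  congr 1
  · rw [Nat.cast_prod, Finset.prod_inv_distrib]
  · refine Finset.sum_congr rfl fun u _ => ?_
    rw [Nat.cast_prod]
    rfl

end Sizes

end Nat.Partition

theorem mainTheorem8 {F : Type u} [Field F] [CharZero F] {n : ℕ} (μ : n.Partition)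
    {r : ℕ} (a : Fin r → ℕ) (ha : Function.Injective a)
    (hparts : ∀ x : ℕ, x ∈ μ.parts ↔ ∃ i, a i = x) :
    (∃! ψ : SymFun F n →ₗ[F] ⨂[F] i, SymFun F (μ.parts.count (a i)), IsPsi μ a ψ) ∧
    ∀ ψ : SymFun F n →ₗ[F] ⨂[F] i, SymFun F (μ.parts.count (a i)), IsPsi μ a ψ →
      ∀ lam : n.Partition,
        ψ (SymFun.h F lam) =
          ∑ π : MultisetPartition (contentMultiset lam) μ,
            PiTensorProduct.tprod F fun i =>
              SymFun.h F (multisetType (π.restrict (a i)) (π.card_restrict (a i))) := by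
  classical
  refine ⟨existsUnique_isPsi μ a, fun ψ hψ lam => ?_⟩
  have hY : (Nat.card μ.young : F) ≠ 0 := Nat.cast_ne_zero.2 Nat.card_pos.ne'
  rw [← frob_wordRep, hψ, μ.frobStab_etaRep, μ.etaFrob_apply]
  -- The factor `|𝔖_μ|` from the orbit count cancels the averaging factor, leaving the number of
  -- fixed tuples as the character value at `u`.
  simp_rw [character_wordRep, ← Nat.cast_sum, μ.sum_fixedCount_young_mul_iota, Nat.cast_mul,
    inv_mul_cancel_left₀ hY, μ.card_fixedTuple ha hparts, Nat.cast_sum, Finset.sum_smul]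
  rw [Finset.sum_comm, Finset.smul_sum]
  refine Finset.sum_congr rfl fun π _ => ?_
  exact μ.sum_prod_fixedCount_smul_cycTensor ha hparts π
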